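/- An instance of Public Event Scheduling with Busy Agents (PSBA) consists of a timeline $T=\{1,\dots,N\}$ of time slots, public events with lengths $l(e)\in\{1,\dots,N\}$, and agents $i\in A$, each with a list $J_i$ of preemptible jobs; a job $j$ has a release time $r_j\ge 1$, a deadline $d_j\ge 1$ and a processing time $p_j\ge 1$ with $p_j\le d_j-r_j+1$. All numbers are given in binary; in particular $N$ need not be polynomially bounded in the input size. A schedule of $J_i$ is feasible if each job $j\in J_i$ is assigned exactly $p_j$ time slots of $T\cap[r_j,d_j]$ and no time slot is assigned to two jobs of $J_i$; each $J_i$ is assumed to have a feasible schedule. A complete event schedule $\mathcal S$ assigns to each event $e$ exactly one start slot $t$ such that the occupied slots $t,\dots,t+l(e)-1$ lie in $T$; events may overlap. Let $\mathsf{agr}_i(\mathcal S)$ be the maximum, over all feasible schedules of $J_i$, of the number of time slots that are occupied by at least one event and in which no job of $J_i$ is processed. The goal is to find a complete event schedule $\mathcal S$ that maximizes $\sum_{i\in A}\mathsf{agr}_i(\mathcal S)$. A $\rho$-approximation algorithm returns, on every instance of the class considered, a complete event schedule whose value is at least $\rho$ times the maximum; polynomial time means polynomial in the bit length of the instance. Theorem.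 (1) Let $\alpha\ge 1$ be real. If there is a polynomial-time $\frac1\alpha$-approximation algorithm for the instances of PSBA with exactly one event, then there is a polynomial-time $\frac1{\alpha+1}$-approximation algorithm for all instances of PSBA. (2) There is a polynomial-time $\frac12$-approximation algorithm for all instances of PSBA. -/

import Mathlib

/-! # Public event scheduling with busy agents, and polynomial time -/

namespace PSBA

/-! ## Computation model

A small deterministic, Turing-complete programming language over binary trees whose leaves are
natural numbers written in binary. Every elementary step is charged the size in bits of the data
that it reads and writes, so that programs and multitape Turing machines simulate each other with
polynomial overhead. -/

/-- Data: natural numbers and pairs. Lists are nested pairs that end in `num 0`. -/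
inductive Val where
  | num (n : ℕ) : Val
  | pair (a b : Val) : Val

/-- The number of bits needed to write down a value, up to a constant factor
(`Nat.size n` is the length of the binary representation of `n`). -/
def Val.size : Val → ℕ
  | .num n => Nat.size n + 1
  | .pair a b => a.size + b.size + 1

/-- Elementary operations. -/
inductive Op where
  | id | const (n : ℕ)
  | fst | snd | isPair
  | add | sub | mul | div | le

/-- The effect of an elementary operation; it returns `num 0` on arguments of the wrong shape.
`sub` is truncated subtraction, `div` is rounded down, and `le` returns `1` for true and `0` for
false. -/
def Op.apply : Op → Val → Val
  | .id, x => x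
  | .const n, _ => .num n
  | .fst, .pair a _ => a
  | .snd, .pair _ b => b
  | .isPair, .pair _ _ => .num 1
  | .add, .pair (.num a) (.num b) => .num (a + b)
  | .sub, .pair (.num a) (.num b) => .num (a - b)
  | .mul, .pair (.num a) (.num b) => .num (a * b)
  | .div, .pair (.num a) (.num b) => .num (a / b)
  | .le, .pair (.num a) (.num b) => .num (if a ≤ b then 1 else 0)
  | _, _ => .num 0

/-- Programs. Each program computes a partial function from values to values:
`seq p q` runs `p` and then `q` on the result; `fork p q` runs `p` and `q` on the same argument and
pairs the results; `cond c p q` runs `p` if the test `c` returns something else than `num 0` and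
`q` otherwise; `loop c p` replaces the argument by its image under `p` as long as the test `c`
returns something else than `num 0`. -/
inductive Prog where
  | op (o : Op) : Prog
  | seq (p q : Prog) : Prog
  | fork (p q : Prog) : Prog
  | cond (c p q : Prog) : Prog
  | loop (c p : Prog) : Prog

/-- `Runs p x y k`: the program `p`, started on `x`, halts with the result `y` after time `k`.
Copying the argument (for `fork`, and for the test of `cond` and `loop`) is charged its size. -/
inductive Runs : Prog → Val → Val → ℕ → Prop where
  | op (o : Op) (x : Val) : Runs (.op o) x (o.apply x) (x.size + (o.apply x).size)
  | seq {p q : Prog} {x y z : Val} {k l : ℕ} :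
      Runs p x y k → Runs q y z l → Runs (.seq p q) x z (k + l)
  | fork {p q : Prog} {x y z : Val} {k l : ℕ} :
      Runs p x y k → Runs q x z l → Runs (.fork p q) x (.pair y z) (x.size + k + l + 1)
  | condTrue {c p q : Prog} {x b y : Val} {k l : ℕ} :
      Runs c x b k → b ≠ .num 0 → Runs p x y l → Runs (.cond c p q) x y (x.size + k + l)
  | condFalse {c p q : Prog} {x y : Val} {k l : ℕ} :
      Runs c x (.num 0) k → Runs q x y l → Runs (.cond c p q) x y (x.size + k + l)
  | loopStop {c p : Prog} {x : Val} {k : ℕ} :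
      Runs c x (.num 0) k → Runs (.loop c p) x x (x.size + k)
  | loopStep {c p : Prog} {x b y z : Val} {k l m : ℕ} :
      Runs c x b k → b ≠ .num 0 → Runs p x y l → Runs (.loop c p) y z m →
      Runs (.loop c p) x z (x.size + k + l + m)

/-- Programs are deterministic: result and running time are determined by the argument. -/
theorem Runs.deterministic {p : Prog} {x y z : Val} {k l : ℕ}
    (h₁ : Runs p x y k) (h₂ : Runs p x z l) : y = z ∧ k = l := by
  induction h₁ generalizing z l with
  | op o x => cases h₂; exact ⟨rfl, rfl⟩
  | seq _ _ ih₁ ih₂ =>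
    cases h₂ with
    | seq a b =>
      obtain ⟨rfl, rfl⟩ := ih₁ a
      obtain ⟨rfl, rfl⟩ := ih₂ b
      exact ⟨rfl, rfl⟩
  | fork _ _ ih₁ ih₂ =>
    cases h₂ with
    | fork a b =>
      obtain ⟨rfl, rfl⟩ := ih₁ a
      obtain ⟨rfl, rfl⟩ := ih₂ b
      exact ⟨rfl, rfl⟩
  | condTrue _ hb _ ih₁ ih₂ =>
    cases h₂ with
    | condTrue a _ b =>
      obtain ⟨rfl, rfl⟩ := ih₁ a
      obtain ⟨rfl, rfl⟩ := ih₂ b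
      exact ⟨rfl, rfl⟩
    | condFalse a _ => exact absurd (ih₁ a).1 hb
  | condFalse _ _ ih₁ ih₂ =>
    cases h₂ with
    | condTrue a hb _ => exact absurd (ih₁ a).1.symm hb
    | condFalse a b =>
      obtain ⟨-, rfl⟩ := ih₁ a
      obtain ⟨rfl, rfl⟩ := ih₂ b
      exact ⟨rfl, rfl⟩
  | loopStop _ ih =>
    cases h₂ with
    | loopStop a => obtain ⟨-, rfl⟩ := ih a; exact ⟨rfl, rfl⟩
    | loopStep a hb _ _ => exact absurd (ih a).1.symm hb
  | loopStep _ hb _ _ ih₁ ih₂ ih₃ =>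
    cases h₂ with
    | loopStop a => exact absurd (ih₁ a).1 hb
    | loopStep a _ b c =>
      obtain ⟨rfl, rfl⟩ := ih₁ a
      obtain ⟨rfl, rfl⟩ := ih₂ b
      obtain ⟨rfl, rfl⟩ := ih₃ c
      exact ⟨rfl, rfl⟩

/-- Encoding of a list, given an encoding of its entries. -/
def encodeList {α : Type} (enc : α → Val) : List α → Val
  | [] => .num 0
  | a :: l => .pair (enc a) (encodeList enc l)

/-! ## The scheduling problem -/

/-- A preemptible job. -/
structure Job where
  /-- the first time slot of the job interval -/
  release : ℕ
  /-- the last time slot of the job interval -/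
  deadline : ℕ
  /-- the number of time slots that the job has to be given -/
  processing : ℕ

/-- The input data. The timeline consists of the time slots `1, …, horizon`. -/
structure Instance where
  horizon : ℕ
  /-- the lengths of the public events -/
  events : List ℕ
  /-- for each agent, the jobs of this agent -/
  agents : List (List Job)

/-- `σ` gives each job `processing` many time slots of the timeline inside the job interval, and
no time slot is used for two jobs. -/
def IsJobSchedule (horizon : ℕ) (jobs : List Job) (σ : Fin jobs.length → Finset ℕ) : Prop :=
  (∀ j, σ j ⊆ Finset.Icc 1 horizon ∩ Finset.Icc (jobs.get j).release (jobs.get j).deadline ∧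
    (σ j).card = (jobs.get j).processing) ∧
  ∀ i j, i ≠ j → Disjoint (σ i) (σ j)

/-- The maximum, over all feasible schedules of the jobs of an agent, of the number of agreement
time slots: the slots of `occupied` (those in which some event takes place) in which no job of the
agent is processed. -/
noncomputable def agr (horizon : ℕ) (jobs : List Job) (occupied : Finset ℕ) : ℕ :=
  sSup {c : ℕ | ∃ σ : Fin jobs.length → Finset ℕ, IsJobSchedule horizon jobs σ ∧
    c = (occupied \ Finset.univ.biUnion σ).card}

namespace Instance

/-- The standing assumptions on an input: time slots are numbered from `1`, lengths and processing
times are positive, no event is longer than the timeline, no job is longer than its interval, and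
the jobs of each agent can be feasibly scheduled. -/
def Valid (I : Instance) : Prop :=
  (∀ l ∈ I.events, 1 ≤ l ∧ l ≤ I.horizon) ∧
  ∀ jobs ∈ I.agents,
    (∀ j ∈ jobs, 1 ≤ j.release ∧ 1 ≤ j.deadline ∧ 1 ≤ j.processing ∧
      j.release + j.processing ≤ j.deadline + 1) ∧
    ∃ σ, IsJobSchedule I.horizon jobs σ

/-- A complete event schedule: a start slot for each event such that the time slots
`t, …, t + l - 1` occupied by the event all lie in the timeline. Events may overlap. -/
def IsEventSchedule (I : Instance) (starts : List ℕ) : Prop :=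
  List.Forall₂ (fun l t => 1 ≤ t ∧ t + l ≤ I.horizon + 1) I.events starts

/-- The set of the time slots that are occupied by some event. -/
def occupied (I : Instance) (starts : List ℕ) : Finset ℕ :=
  (I.events.zip starts).toFinset.biUnion fun e => Finset.Ico e.2 (e.2 + e.1)

/-- The total agreement of all agents. -/
noncomputable def totalAgr (I : Instance) (starts : List ℕ) : ℕ :=
  (I.agents.map fun jobs => agr I.horizon jobs (I.occupied starts)).sum

/-- The input as it is presented to a program. -/
def encode (I : Instance) : Val :=
  .pair (.num I.horizon) (.pair (encodeList .num I.events)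
    (encodeList (encodeList fun j : Job =>
      .pair (.num j.release) (.pair (.num j.deadline) (.num j.processing))) I.agents))

end Instance

/-- `P` is a polynomial-time `ρ`-approximation algorithm for the inputs in the class `C`: on each
valid input in `C` it halts, within a time that is bounded by a fixed polynomial in the size of the
input in bits, and returns a complete event schedule whose total agreement is at least `ρ` times
the maximum. -/
def IsPolyTimeApprox (C : Set Instance) (ρ : ℝ) (P : Prog) : Prop :=
  ∃ q : Polynomial ℕ, ∀ I ∈ C, I.Valid →
    ∃ (starts : List ℕ) (k : ℕ),
      Runs P I.encode (encodeList .num starts) k ∧ k ≤ q.eval I.encode.size ∧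
      I.IsEventSchedule starts ∧
      ∀ starts', I.IsEventSchedule starts' → ρ * (I.totalAgr starts' : ℝ) ≤ I.totalAgr starts

/-- The inputs with exactly one event. -/
def oneEvent : Set Instance := {I | I.events.length = 1}

end PSBA

/-!
The agreement of an agent obeys a min-max formula. Let `window N j` be the slots in which job `j`
may be processed, and let `demand N jobs S` be the total processing time of the jobs whose windows
lie inside `S`. By Hall's theorem, applied to the units of the jobs and to further units that stand
for free slots of `X`, the agreement with `X` is the minimum of `|X ∪ S| - demand S` over all sets
`S` of slots (`Feasible.agr_spec`). As `demand` is supermodular, the agreement is submodular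
(`Feasible.agr_submodular`).

Part (1). The events are placed one after the other, each so that the gain in agreement is within a
factor `α` of the best possible gain. Submodularity gives the factor `α + 1` for the whole schedule
(`GreedyState`). The gain over the occupied set `X` is itself the agreement in an input with one
event: replace the processing times of an agent by a maximal vector of smaller ones that fits
outside `X`, and let further jobs keep the agent busy during `X` (`ValidJobs.agr_residual`). The
reduced processing times are computed greedily from Hall's condition, which has to be tested only
for the intervals from a release time to a deadline (`demand_le_card_sdiff`), so that a timeline of
exponential length does no harm. The set `X` is stored as a list of disjoint intervals.

Part (2). For a single event the problem can be solved exactly, so that part (1) with `α = 1`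
applies. While the two ends of the interval occupied by the event stay between consecutive release
times and deadlines, the slots at each end are interchangeable, and therefore the agreement is a
concave function of the start slot (`Feasible.agr_concave`). Binary search in each of the
polynomially many pieces finds the maximum (`bestStart_spec`).

Running times are not computed explicitly. The functions that some program computes in polynomial
time (`PolyTimeOn`) are shown to be closed under composition, case distinction, and those loops and
folds whose intermediate results stay polynomially small (`PolyTimeOn.loop`, `PolyTimeOn.foldl`).
Each algorithm is written as an ordinary function, and `fun_prop` assembles its program.
-/

namespace PSBA

/-! ### Polynomial-time functions -/

/-- Types whose elements are presented to programs as values. -/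
class Data (α : Type) where
  /-- the value that presents an element -/
  enc : α → Val

instance : Data ℕ := ⟨.num⟩

instance {α β : Type} [Data α] [Data β] : Data (α × β) :=
  ⟨fun x => .pair (Data.enc x.1) (Data.enc x.2)⟩

instance {α : Type} [Data α] : Data (List α) := ⟨encodeList Data.enc⟩

instance : Data Job :=
  ⟨fun j => .pair (.num j.release) (.pair (.num j.deadline) (.num j.processing))⟩

instance : Data Instance := ⟨Instance.encode⟩

instance : Inhabited Job := ⟨⟨0, 0, 0⟩⟩

section Framework

variable {α β γ σ : Type} [Data α] [Data β] [Data γ] [Data σ]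

/-- The number of bits of the presentation of an element. -/
def bits (a : α) : ℕ := (Data.enc a).size

theorem bits_nat (n : ℕ) : bits n = Nat.size n + 1 := rfl

theorem bits_pair (a : α) (b : β) : bits (a, b) = bits a + bits b + 1 := rfl

theorem bits_nil : bits ([] : List α) = 1 := rfl

theorem bits_cons (a : α) (l : List α) : bits (a :: l) = bits a + bits l + 1 := rfl

theorem bits_job (j : Job) :
    bits j = bits j.release + (bits j.deadline + bits j.processing + 1) + 1 := rfl

theorem bits_nat_mono {m n : ℕ} (h : m ≤ n) : bits m ≤ bits n := by
  simpa [bits_nat] using Nat.size_le_size h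

theorem one_le_bits (a : α) : 1 ≤ bits a := by
  unfold bits
  cases Data.enc a <;> simp [Val.size]

theorem length_le_bits (l : List α) : l.length ≤ bits l := by
  induction l with
  | nil => simp
  | cons a l ih => rw [bits_cons, List.length_cons]; omega

theorem bits_le_of_mem {a : α} {l : List α} (h : a ∈ l) : bits a ≤ bits l := by
  induction l with
  | nil => simp at h
  | cons b l ih =>
    rw [bits_cons]
    rcases List.mem_cons.1 h with rfl | h
    · omega
    · have := ih h; omega

theorem bits_drop_le (l : List α) (i : ℕ) : bits (l.drop i) ≤ bits l := by
  induction l generalizing i with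
  | nil => simp
  | cons a l ih =>
    cases i with
    | zero => simp
    | succ i => rw [List.drop_succ_cons, bits_cons]; have := ih i; omega

/-- Polynomials with natural coefficients are monotone. -/
theorem eval_le_eval (q : Polynomial ℕ) {m n : ℕ} (h : m ≤ n) : q.eval m ≤ q.eval n := by
  simp only [Polynomial.eval_eq_sum, Polynomial.sum]
  gcongr

/-- `b` is bounded on `D` by a polynomial in the number of bits of the argument. -/
def PolyBdd (b : α → ℕ) (D : Set α) : Prop :=
  ∃ q : Polynomial ℕ, ∀ a ∈ D, b a ≤ q.eval (bits a)

namespace PolyBdd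

variable {b c : α → ℕ} {D : Set α}

theorem mono (h : PolyBdd c D) (hb : ∀ a ∈ D, b a ≤ c a) : PolyBdd b D :=
  let ⟨q, hq⟩ := h
  ⟨q, fun a ha => (hb a ha).trans (hq a ha)⟩

theorem const (n : ℕ) : PolyBdd (fun _ => n) D := ⟨Polynomial.C n, by simp⟩

theorem bits : PolyBdd bits D := ⟨Polynomial.X, by simp⟩

theorem add (hb : PolyBdd b D) (hc : PolyBdd c D) : PolyBdd (fun a => b a + c a) D :=
  let ⟨q, hq⟩ := hb
  let ⟨r, hr⟩ := hc
  ⟨q + r, fun a ha => by rw [Polynomial.eval_add]; exact add_le_add (hq a ha) (hr a ha)⟩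

theorem mul (hb : PolyBdd b D) (hc : PolyBdd c D) : PolyBdd (fun a => b a * c a) D :=
  let ⟨q, hq⟩ := hb
  let ⟨r, hr⟩ := hc
  ⟨q * r, fun a ha => by rw [Polynomial.eval_mul]; exact Nat.mul_le_mul (hq a ha) (hr a ha)⟩

theorem eval (hb : PolyBdd b D) (q : Polynomial ℕ) : PolyBdd (fun a => q.eval (b a)) D :=
  let ⟨r, hr⟩ := hb
  ⟨q.comp r, fun a ha => by rw [Polynomial.eval_comp]; exact eval_le_eval q (hr a ha)⟩

theorem subset {E : Set α} (hb : PolyBdd b D) (h : E ⊆ D) : PolyBdd b E :=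
  let ⟨q, hq⟩ := hb
  ⟨q, fun a ha => hq a (h ha)⟩

end PolyBdd

/-- Some program computes `f` on `D` within polynomial time. -/
def PolyTimeOn (f : α → β) (D : Set α) : Prop :=
  ∃ (p : Prog) (k : α → ℕ), PolyBdd k D ∧ ∀ a ∈ D, Runs p (Data.enc a) (Data.enc (f a)) (k a)

/-- Some program computes `f` within polynomial time. -/
@[fun_prop]
def PolyTime (f : α → β) : Prop := PolyTimeOn f Set.univ

/-- Writing down the result takes time, so that the result is never larger than the running
time. -/
theorem Runs.size_le {p : Prog} {x y : Val} {k : ℕ} (h : Runs p x y k) : y.size ≤ k := by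
  induction h with
  | op => omega
  | seq => omega
  | fork => simp only [Val.size]; omega
  | condTrue => omega
  | condFalse => omega
  | loopStop => omega
  | loopStep => omega

namespace PolyTimeOn

variable {D : Set α}

theorem bits {f : α → β} (h : PolyTimeOn f D) : PolyBdd (fun a => PSBA.bits (f a)) D :=
  let ⟨_, _, hk, hr⟩ := h
  hk.mono fun a ha => (hr a ha).size_le

theorem subset {f : α → β} {E : Set α} (h : PolyTimeOn f D) (hE : E ⊆ D) : PolyTimeOn f E :=
  let ⟨p, k, hk, hr⟩ := h
  ⟨p, k, hk.subset hE, fun a ha => hr a (hE ha)⟩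

theorem congr {f g : α → β} (h : PolyTimeOn f D) (hE : ∀ a ∈ D, f a = g a) :
    PolyTimeOn g D :=
  let ⟨p, k, hk, hr⟩ := h
  ⟨p, k, hk, fun a ha => hE a ha ▸ hr a ha⟩

theorem op (o : Op) {f : α → β} (h : ∀ a ∈ D, o.apply (Data.enc a) = Data.enc (f a))
    (hb : PolyBdd (fun a => PSBA.bits (f a)) D) : PolyTimeOn f D :=
  ⟨.op o, fun a => PSBA.bits a + PSBA.bits (f a), PolyBdd.bits.add hb, fun a ha => by
    have := Runs.op o (Data.enc a)
    rwa [h a ha] at this⟩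

theorem comp {g : β → γ} {f : α → β} {E : Set β} (hg : PolyTimeOn g E) (hf : PolyTimeOn f D)
    (h : ∀ a ∈ D, f a ∈ E) : PolyTimeOn (fun a => g (f a)) D := by
  obtain ⟨p, k, hk, hr⟩ := hg
  have hb := hf.bits
  obtain ⟨p', k', hk', hr'⟩ := hf
  obtain ⟨q, hq⟩ := hk
  refine ⟨.seq p' p, fun a => k' a + k (f a),
    hk'.add ((hb.eval q).mono fun a ha => hq _ (h a ha)), fun a ha => ?_⟩
  exact .seq (hr' a ha) (hr _ (h a ha))

theorem pair {f : α → β} {g : α → γ} (hf : PolyTimeOn f D) (hg : PolyTimeOn g D) :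
    PolyTimeOn (fun a => (f a, g a)) D := by
  obtain ⟨p, k, hk, hr⟩ := hf
  obtain ⟨p', k', hk', hr'⟩ := hg
  exact ⟨.fork p p', _, ((PolyBdd.bits.add hk).add hk').add (.const 1),
    fun a ha => .fork (hr a ha) (hr' a ha)⟩

/-- Case distinction by a test that returns a natural number. -/
theorem cond {t : α → ℕ} {f g : α → β} (ht : PolyTimeOn t D)
    (hf : PolyTimeOn f {a ∈ D | t a ≠ 0}) (hg : PolyTimeOn g {a ∈ D | t a = 0}) :
    PolyTimeOn (fun a => if t a = 0 then g a else f a) D := by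
  obtain ⟨c, k, hk, hr⟩ := ht
  obtain ⟨p, k', ⟨q, hq⟩, hr'⟩ := hf
  obtain ⟨p', k'', ⟨q', hq'⟩, hr''⟩ := hg
  refine ⟨.cond c p p', fun a => PSBA.bits a + k a + if t a = 0 then k'' a else k' a,
    (PolyBdd.bits.add hk).add (.mono (c := fun a => q.eval (PSBA.bits a) + q'.eval (PSBA.bits a))
      ((PolyBdd.bits.eval q).add (PolyBdd.bits.eval q')) fun a ha => ?_), fun a ha => ?_⟩
  · split_ifs with h
    · exact (hq' a ⟨ha, h⟩).trans (Nat.le_add_left _ _)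
    · exact (hq a ⟨ha, h⟩).trans (Nat.le_add_right _ _)
  · have h1 := hr a ha
    beta_reduce
    split_ifs with h
    · rw [h] at h1
      exact .condFalse h1 (hr'' a ⟨ha, h⟩)
    · exact .condTrue h1 (fun e => h (by injection e)) (hr' a ⟨ha, h⟩)

/-- A loop whose states `s a 0, s a 1, …, s a (n a)` stay polynomially small and that stops after
polynomially many rounds. -/
theorem loop {E : Set σ} {t : σ → ℕ} {f : σ → σ} {n : α → ℕ} {s : α → ℕ → σ} {B : α → ℕ}
    (ht : PolyTime t) (hf : PolyTimeOn f E) (hs : PolyTimeOn (fun a => s a 0) D)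
    (hn : PolyBdd n D) (hB : PolyBdd B D) (hsB : ∀ a ∈ D, ∀ i ≤ n a, PSBA.bits (s a i) ≤ B a)
    (hstep : ∀ a ∈ D, ∀ i < n a, s a i ∈ E ∧ t (s a i) ≠ 0 ∧ f (s a i) = s a (i + 1))
    (hend : ∀ a ∈ D, t (s a (n a)) = 0) : PolyTimeOn (fun a => s a (n a)) D := by
  obtain ⟨c, k, ⟨q, hq⟩, hr⟩ := ht
  obtain ⟨p, k', ⟨q', hq'⟩, hr'⟩ := hf
  -- the remaining rounds, counted from the end
  have key : ∀ a ∈ D, ∀ m ≤ n a, ∃ K ≤ (m + 1) * (B a + q.eval (B a) + q'.eval (B a)),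
      Runs (.loop c p) (Data.enc (s a (n a - m))) (Data.enc (s a (n a))) K := by
    intro a ha m hm
    induction m with
    | zero =>
      have h1 := hr (s a (n a)) trivial
      rw [hend a ha] at h1
      refine ⟨_, ?_, .loopStop h1⟩
      have h2 := hsB a ha (n a) le_rfl
      have h3 := (hq (s a (n a)) trivial).trans (eval_le_eval q h2)
      change PSBA.bits (s a (n a)) + _ ≤ _
      simp only [zero_add, one_mul]
      omega
    | succ m ih =>
      obtain ⟨K, hK, hrun⟩ := ih (by omega)
      obtain ⟨hE, hne, heq⟩ := hstep a ha (n a - (m + 1)) (by omega)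
      have e : n a - (m + 1) + 1 = n a - m := by omega
      rw [e] at heq
      have h1 := hr (s a (n a - (m + 1))) trivial
      have h2 := hr' _ hE
      rw [heq] at h2
      refine ⟨_, ?_, .loopStep h1 (fun e => hne (by injection e)) h2 hrun⟩
      have h3 := hsB a ha (n a - (m + 1)) (by omega)
      have h4 := (hq (s a (n a - (m + 1))) trivial).trans (eval_le_eval q h3)
      have h5 := (hq' _ hE).trans (eval_le_eval q' h3)
      change PSBA.bits (s a (n a - (m + 1))) + _ + _ + _ ≤ _
      rw [add_mul (m + 1)]
      omega
  obtain ⟨p₀, k₀, hk₀, hr₀⟩ := hs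
  choose! K hK hrun using fun a ha => key a ha (n a) le_rfl
  simp only [Nat.sub_self] at hrun
  refine ⟨.seq p₀ (.loop c p), fun a => k₀ a + K a, hk₀.add (.mono ?_ hK),
    fun a ha => .seq (hr₀ a ha) (hrun a ha)⟩
  exact (hn.add (.const 1)).mul ((hB.add (hB.eval q)).add (hB.eval q'))

end PolyTimeOn

namespace PolyTime

theorem on {f : α → β} (h : PolyTime f) (D : Set α) : PolyTimeOn f D := h.subset D.subset_univ

theorem bdd {f : α → β} (h : PolyTime f) (D : Set α) : PolyBdd (fun a => bits (f a)) D :=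
  (h.on D).bits

@[fun_prop]
theorem id : PolyTime (fun a : α => a) := PolyTimeOn.op .id (fun _ _ => rfl) .bits

@[fun_prop]
theorem comp {g : β → γ} {f : α → β} (hg : PolyTime g) (hf : PolyTime f) :
    PolyTime (fun a => g (f a)) :=
  PolyTimeOn.comp hg hf fun _ _ => trivial

@[fun_prop]
theorem const (b : β) : PolyTime (fun _ : α => b) := by
  have key : ∀ v : Val, ∃ (p : Prog) (k : α → ℕ), PolyBdd k Set.univ ∧
      ∀ a, Runs p (Data.enc a) v (k a) := by
    intro v
    induction v with
    | num n => exact ⟨_, _, PolyBdd.bits.add (.const (Val.size (.num n))),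
        fun a => .op (.const n) (Data.enc a)⟩
    | pair v w hv hw =>
      obtain ⟨p, k, hk, hr⟩ := hv
      obtain ⟨p', k', hk', hr'⟩ := hw
      exact ⟨.fork p p', _, ((PolyBdd.bits.add hk).add hk').add (.const 1),
        fun a => .fork (hr a) (hr' a)⟩
  obtain ⟨p, k, hk, hr⟩ := key (Data.enc b)
  exact ⟨p, k, hk, fun a _ => hr a⟩

@[fun_prop]
theorem prodMk {f : α → β} {g : α → γ} (hf : PolyTime f) (hg : PolyTime g) :
    PolyTime (fun a => (f a, g a)) :=
  PolyTimeOn.pair hf hg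

@[fun_prop]
theorem prodFst : PolyTime (Prod.fst : α × β → α) :=
  PolyTimeOn.op .fst (fun _ _ => rfl) (PolyBdd.bits.mono fun x _ => by
    rw [show bits x = bits x.1 + bits x.2 + 1 from rfl]; omega)

@[fun_prop]
theorem prodSnd : PolyTime (Prod.snd : α × β → β) :=
  PolyTimeOn.op .snd (fun _ _ => rfl) (PolyBdd.bits.mono fun x _ => by
    rw [show bits x = bits x.1 + bits x.2 + 1 from rfl]; omega)

/-- Binary operations on natural numbers that increase the number of bits at most additively. -/
theorem natOp (o : Op) {h : ℕ → ℕ → ℕ}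
    (ho : ∀ m n, o.apply (.pair (.num m) (.num n)) = .num (h m n))
    (hs : ∀ m n, Nat.size (h m n) ≤ Nat.size m + Nat.size n + 1) {f g : α → ℕ} (hf : PolyTime f)
    (hg : PolyTime g) : PolyTime (fun a => h (f a) (g a)) := by
  have : PolyTime (fun x : ℕ × ℕ => h x.1 x.2) :=
    PolyTimeOn.op o (fun x _ => ho x.1 x.2) (PolyBdd.bits.mono fun x _ => by
      rw [show bits x = bits x.1 + bits x.2 + 1 from rfl]
      have := hs x.1 x.2
      simp only [bits_nat]
      omega)
  exact this.comp (hf.prodMk hg)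

@[fun_prop]
theorem natAdd {f g : α → ℕ} (hf : PolyTime f) (hg : PolyTime g) :
    PolyTime (fun a => f a + g a) :=
  natOp .add (fun _ _ => rfl) (fun m n => by
    have h1 := Nat.lt_size_self m
    have h2 := Nat.lt_size_self n
    have h3 : 2 ^ m.size ≤ 2 ^ (m.size + n.size) := Nat.pow_le_pow_right (by omega) (by omega)
    have h4 : 2 ^ n.size ≤ 2 ^ (m.size + n.size) := Nat.pow_le_pow_right (by omega) (by omega)
    rw [Nat.size_le, pow_succ]
    omega) hf hg

@[fun_prop]
theorem natSub {f g : α → ℕ} (hf : PolyTime f) (hg : PolyTime g) :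
    PolyTime (fun a => f a - g a) :=
  natOp .sub (fun _ _ => rfl) (fun m n => by
    have := Nat.size_le_size (Nat.sub_le m n)
    omega) hf hg

@[fun_prop]
theorem natDiv {f g : α → ℕ} (hf : PolyTime f) (hg : PolyTime g) :
    PolyTime (fun a => f a / g a) :=
  natOp .div (fun _ _ => rfl) (fun m n => by
    have := Nat.size_le_size (Nat.div_le_self m n)
    omega) hf hg

@[fun_prop]
theorem ite_le {f g : α → ℕ} {u v : α → β} (hf : PolyTime f) (hg : PolyTime g) (hu : PolyTime u)
    (hv : PolyTime v) : PolyTime (fun a => if f a ≤ g a then u a else v a) := by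
  have ht : PolyTime (fun a => if f a ≤ g a then 1 else 0) :=
    natOp .le (h := fun m n => if m ≤ n then 1 else 0) (fun _ _ => rfl) (fun m n => by
      split_ifs <;> simp) hf hg
  refine (PolyTimeOn.cond ht (hu.on _) (hv.on _)).congr fun a _ => ?_
  by_cases h : f a ≤ g a <;> simp [h]

@[fun_prop]
theorem natMin {f g : α → ℕ} (hf : PolyTime f) (hg : PolyTime g) :
    PolyTime (fun a => min (f a) (g a)) := by
  simp only [min_def]
  fun_prop

@[fun_prop]
theorem natMax {f g : α → ℕ} (hf : PolyTime f) (hg : PolyTime g) :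
    PolyTime (fun a => max (f a) (g a)) := by
  simp only [max_def]
  fun_prop

@[fun_prop]
theorem job_release : PolyTime Job.release :=
  PolyTimeOn.op .fst (fun _ _ => rfl) (PolyBdd.bits.mono fun x _ => by rw [bits_job]; omega)

theorem job_tail : PolyTime (fun j : Job => (j.deadline, j.processing)) :=
  PolyTimeOn.op .snd (fun _ _ => rfl) (PolyBdd.bits.mono fun x _ => by
    rw [bits_job, bits_pair]; omega)

@[fun_prop]
theorem job_deadline : PolyTime Job.deadline := prodFst.comp job_tail

@[fun_prop]
theorem job_processing : PolyTime Job.processing := prodSnd.comp job_tail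

@[fun_prop]
theorem job_mk {r d p : α → ℕ} (hr : PolyTime r) (hd : PolyTime d) (hp : PolyTime p) :
    PolyTime (fun a => Job.mk (r a) (d a) (p a)) := hr.prodMk (hd.prodMk hp)

theorem instance_tuple :
    PolyTime (fun I : Instance => (I.horizon, I.events, I.agents)) := PolyTime.id (α := Instance)

@[fun_prop]
theorem instance_horizon : PolyTime Instance.horizon := prodFst.comp instance_tuple

@[fun_prop]
theorem instance_events : PolyTime Instance.events :=
  prodFst.comp (prodSnd.comp instance_tuple)

@[fun_prop]
theorem instance_agents : PolyTime Instance.agents :=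
  prodSnd.comp (prodSnd.comp instance_tuple)

theorem instance_mk {N : α → ℕ} {e : α → List ℕ} {A : α → List (List Job)} {D : Set α}
    (hN : PolyTimeOn N D) (he : PolyTimeOn e D) (hA : PolyTimeOn A D) :
    PolyTimeOn (fun a => Instance.mk (N a) (e a) (A a)) D := hN.pair (he.pair hA)

@[fun_prop]
theorem list_cons {f : α → β} {g : α → List β} (hf : PolyTime f) (hg : PolyTime g) :
    PolyTime (fun a => f a :: g a) := hf.prodMk hg

@[fun_prop]
theorem list_tail : PolyTime (List.tail : List α → List α) :=
  PolyTimeOn.op .snd (fun l _ => by cases l <;> rfl)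
    (PolyBdd.bits.mono fun l _ => by
      cases l with
      | nil => exact le_rfl
      | cons a l => rw [bits_cons, List.tail_cons]; omega)

/-- The head of a nonempty list. -/
theorem list_headI [Inhabited α] : PolyTimeOn (List.headI : List α → α) {l | l ≠ []} :=
  PolyTimeOn.op .fst (fun l hl => by cases l with
      | nil => exact absurd rfl hl
      | cons => rfl)
    (PolyBdd.bits.mono fun l hl => by
      cases l with
      | nil => exact absurd rfl hl
      | cons a l => rw [bits_cons, List.headI_cons]; omega)

/-- The first entry of a list of natural numbers, or `0`. -/
@[fun_prop]
theorem list_nat_headI : PolyTime (List.headI : List ℕ → ℕ) :=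
  PolyTimeOn.op .fst (fun l _ => by cases l <;> rfl)
    (PolyBdd.bits.mono fun l _ => by
      cases l with
      | nil => exact le_rfl
      | cons a l => rw [bits_cons, List.headI_cons]; omega)

theorem list_nonempty : PolyTime (fun l : List α => if l.isEmpty then 0 else 1) :=
  PolyTimeOn.op .isPair (fun l _ => by cases l <;> rfl)
    (PolyBdd.mono (.const 2) fun l _ => by cases l <;> simp [bits_nat])

end PolyTime

/-! ### Folds over lists -/

/-- Folding a list is done in polynomial time if the intermediate results stay polynomially
small. -/
theorem PolyTimeOn.foldl [Inhabited α] {L : γ → List α} {init : γ → β} {step : γ → β → α → β}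
    {D : Set γ} {E : Set (γ × β × α)} {B : γ → ℕ} (hL : PolyTimeOn L D) (hi : PolyTimeOn init D)
    (hs : PolyTimeOn (fun x : γ × β × α => step x.1 x.2.1 x.2.2) E) (hB : PolyBdd B D)
    (hsB : ∀ c ∈ D, ∀ l, l <+: L c → PSBA.bits (l.foldl (step c) (init c)) ≤ B c)
    (hE : ∀ c ∈ D, ∀ l a, l ++ [a] <+: L c → (c, l.foldl (step c) (init c), a) ∈ E) :
    PolyTimeOn (fun c => (L c).foldl (step c) (init c)) D := by
  let s : γ → ℕ → γ × List α × β :=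
    fun c i => (c, (L c).drop i, ((L c).take i).foldl (step c) (init c))
  let F : Set (γ × List α × β) :=
    {x | x.2.1 ≠ [] ∧ (x.1, x.2.2, x.2.1.headI) ∈ E}
  have hhead : PolyTimeOn (fun x : γ × List α × β => x.2.1.headI) F :=
    PolyTime.list_headI.comp (PolyTime.on (by fun_prop) F) fun x hx => hx.1
  have hbody : PolyTimeOn (fun x : γ × List α × β =>
      (x.1, x.2.1.tail, step x.1 x.2.2 x.2.1.headI)) F := by
    refine PolyTimeOn.pair (PolyTime.on (by fun_prop) F)
      (.pair (PolyTime.on (by fun_prop) F) ?_)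
    exact hs.comp (f := fun x : γ × List α × β => (x.1, x.2.2, x.2.1.headI))
      (.pair (PolyTime.on (by fun_prop) F) (.pair (PolyTime.on (by fun_prop) F) hhead))
      fun x hx => hx.2
  have hloop := PolyTimeOn.loop (D := D) (n := fun c => (L c).length) (s := s)
    (t := fun x => if x.2.1.isEmpty then 0 else 1)
    (B := fun c => PSBA.bits c + (PSBA.bits (L c) + B c + 1) + 1)
    (PolyTime.list_nonempty.comp (f := fun x : γ × List α × β => x.2.1) (by fun_prop)) hbody
    (by simpa [s] using (PolyTime.id.on D).pair (hL.pair hi))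
    (hL.bits.mono fun c _ => length_le_bits _)
    ((PolyBdd.bits.add ((hL.bits.add hB).add (.const 1))).add (.const 1))
    (fun c hc i _ => by
      have h1 := hsB c hc _ ((L c).take_prefix i)
      have h2 := bits_drop_le (L c) i
      simp only [s, bits_pair]
      omega)
    (fun c hc i hi => by
      have h1 : (L c).drop i = (L c)[i] :: (L c).drop (i + 1) := List.drop_eq_getElem_cons hi
      refine ⟨⟨?_, ?_⟩, ?_, ?_⟩
      · simp only [s]
        rw [h1]
        exact List.cons_ne_nil _ _
      · simp only [s, h1, List.headI_cons]
        refine hE c hc _ _ ?_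
        rw [List.take_append_getElem hi]
        exact (L c).take_prefix _
      · simp only [s]
        have h2 : ((L c).drop i).isEmpty = false := by rw [h1]; rfl
        simp [h2]
      · simp only [s, h1, List.headI_cons, List.tail_cons]
        rw [← List.take_append_getElem hi, List.foldl_append]
        rfl)
    (fun c _ => by simp [s])
  exact ((PolyTime.on (f := fun x : γ × List α × β => x.2.2) (by fun_prop) Set.univ).comp hloop
    fun _ _ => trivial).congr fun c _ => by simp [s]

/-- Folding a list is done in polynomial time if each entry increases the result additively. -/
theorem PolyTimeOn.foldl_of_add [Inhabited α] {L : γ → List α} {init : γ → β}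
    {step : γ → β → α → β} {D : Set γ} {E : Set (γ × β × α)} {B : γ → ℕ} (hL : PolyTimeOn L D)
    (hi : PolyTimeOn init D) (hs : PolyTimeOn (fun x : γ × β × α => step x.1 x.2.1 x.2.2) E)
    (hB : PolyBdd B D)
    (hsB : ∀ c b a, c ∈ D → (c, b, a) ∈ E → a ∈ L c → PSBA.bits (step c b a) ≤ PSBA.bits b + B c)
    (hE : ∀ c ∈ D, ∀ l a, l ++ [a] <+: L c → (c, l.foldl (step c) (init c), a) ∈ E) :
    PolyTimeOn (fun c => (L c).foldl (step c) (init c)) D := by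
  refine PolyTimeOn.foldl (B := fun c => PSBA.bits (init c) + PSBA.bits (L c) * B c) hL hi hs
    (hi.bits.add (hL.bits.mul hB)) (fun c hc l hl => ?_) hE
  have key : PSBA.bits (l.foldl (step c) (init c)) ≤ PSBA.bits (init c) + l.length * B c := by
    induction l using List.reverseRecOn with
    | nil => simp
    | append_singleton l a ih =>
      have h1 := ih ((List.prefix_append l [a]).trans hl)
      have h2 := hsB c _ a hc (hE c hc l a hl) (hl.subset (by simp))
      rw [List.foldl_append, List.length_append, add_mul]
      simp only [List.foldl_cons, List.foldl_nil, List.length_singleton]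
      omega
  refine key.trans (Nat.add_le_add_left (Nat.mul_le_mul_right _ ?_) _)
  exact hl.length_le.trans (length_le_bits _)

/-- The version of `PolyTimeOn.foldl_of_add` for total functions, without side conditions on
the arguments. -/
theorem PolyTime.foldl_of_add [Inhabited α] {L : γ → List α} {init : γ → β} {step : γ → β → α → β}
    {g : γ × α → ℕ} (hL : PolyTime L) (hi : PolyTime init)
    (hs : PolyTime (fun x : γ × β × α => step x.1 x.2.1 x.2.2)) (hg : PolyBdd g Set.univ)
    (hsB : ∀ c b a, bits (step c b a) ≤ bits b + g (c, a)) :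
    PolyTime (fun c => (L c).foldl (step c) (init c)) := by
  obtain ⟨q, hq⟩ := hg
  refine PolyTimeOn.foldl_of_add (B := fun c => q.eval (bits c + bits (L c) + 1)) hL hi hs
    (((PolyBdd.bits.add (PolyTimeOn.bits hL)).add (.const 1)).eval q) (fun c b a _ _ ha => ?_)
    (fun _ _ _ _ _ => trivial)
  refine (hsB c b a).trans (Nat.add_le_add_left ((hq _ trivial).trans (eval_le_eval q ?_)) _)
  have := bits_le_of_mem ha
  rw [bits_pair]
  omega

end Framework

section Lists

variable {α β γ σ : Type} [Data α] [Data β] [Data γ] [Data σ]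

namespace PolyTime

@[fun_prop]
theorem list_reverse [Inhabited α] {L : γ → List α} (hL : PolyTime L) :
    PolyTime (fun c => (L c).reverse) := by
  have h : PolyTime (fun c => (L c).foldl (fun acc a => a :: acc) []) :=
    foldl_of_add (g := fun x => bits x + 1) hL (const _) (by fun_prop) (PolyBdd.bits.add (.const 1))
      fun c b a => by rw [bits_cons, bits_pair]; omega
  simpa using h

@[fun_prop]
theorem list_append [Inhabited α] {L M : γ → List α} (hL : PolyTime L) (hM : PolyTime M) :
    PolyTime (fun c => L c ++ M c) := by
  have h : PolyTime (fun c => (L c).reverse.foldl (fun acc a => a :: acc) (M c)) :=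
    foldl_of_add (g := fun x => bits x + 1) (by fun_prop) hM (by fun_prop)
      (PolyBdd.bits.add (.const 1)) fun c b a => by rw [bits_cons, bits_pair]; omega
  simpa using h

theorem bits_append_le (l m : List α) : bits (l ++ m) ≤ bits l + bits m := by
  induction l with
  | nil => simp
  | cons a l ih => rw [List.cons_append, bits_cons, bits_cons]; omega

@[fun_prop]
theorem list_flatMap [Inhabited α] [Inhabited β] {L : γ → List α} {f : γ → α → List β}
    (hL : PolyTime L) (hf : PolyTime (fun x : γ × α => f x.1 x.2)) :
    PolyTime (fun c => (L c).flatMap (f c)) := by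
  have h : PolyTime (fun c => (L c).reverse.foldl (fun acc a => f c a ++ acc) []) :=
    foldl_of_add (g := fun x => bits (f x.1 x.2)) (by fun_prop) (const _)
      (by
        have : PolyTime (fun x : γ × List β × α => f x.1 x.2.2) :=
          hf.comp (f := fun x : γ × List β × α => (x.1, x.2.2)) (by fun_prop)
        fun_prop)
      (hf.bdd _) fun c b a => by
        have := bits_append_le (f c a) b
        dsimp only
        omega
  convert h using 2 with c
  rw [List.foldl_reverse]
  induction L c with
  | nil => rfl
  | cons a l ih => rw [List.flatMap_cons, ih]; rfl

@[fun_prop]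
theorem list_map [Inhabited α] [Inhabited β] {L : γ → List α} {f : γ → α → β}
    (hL : PolyTime L) (hf : PolyTime (fun x : γ × α => f x.1 x.2)) :
    PolyTime (fun c => (L c).map (f c)) := by
  have h : PolyTime (fun c => (L c).flatMap (fun a => [f c a])) :=
    list_flatMap hL (list_cons hf (const _))
  simpa only [← List.map_eq_flatMap] using h

@[fun_prop]
theorem list_sum {L : γ → List ℕ} (hL : PolyTime L) : PolyTime (fun c => (L c).sum) := by
  have h : PolyTime (fun c => (L c).foldl (fun s a => s + a) 0) :=
    foldl_of_add (g := fun x => bits x) hL (const _) (by fun_prop) PolyBdd.bits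
      fun c b a => by
        rw [bits_pair]
        have h1 := Nat.lt_size_self b
        have h2 := Nat.lt_size_self a
        have h3 : 2 ^ b.size ≤ 2 ^ (b.size + a.size) := Nat.pow_le_pow_right (by omega) (by omega)
        have h4 : 2 ^ a.size ≤ 2 ^ (b.size + a.size) := Nat.pow_le_pow_right (by omega) (by omega)
        have h5 : Nat.size (b + a) ≤ b.size + a.size + 1 := by
          rw [Nat.size_le, pow_succ]
          omega
        simp only [bits_nat]
        omega
  simpa only [List.sum_eq_foldl] using h

/-- The minimum of a list of natural numbers and a further number. -/
@[fun_prop]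
theorem list_foldl_min {L : γ → List ℕ} {m : γ → ℕ} (hL : PolyTime L) (hm : PolyTime m) :
    PolyTime (fun c => (L c).foldl min (m c)) :=
  foldl_of_add (g := fun _ => 0) hL hm (by fun_prop) (.const 0)
    fun c b a => bits_nat_mono (min_le_left b a)

/-- Repeating a step as many times as a number has binary digits: halving the number serves as
the counter. -/
theorem iterate_size {n : γ → ℕ} {init : γ → β} {step : γ → β → β} {B : γ → ℕ} (hn : PolyTime n)
    (hi : PolyTime init) (hs : PolyTime (fun x : γ × β => step x.1 x.2))
    (hB : PolyBdd B Set.univ) (hsB : ∀ c i, bits ((step c)^[i] (init c)) ≤ B c) :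
    PolyTime (fun c => (step c)^[Nat.size (n c)] (init c)) := by
  let s : γ → ℕ → γ × ℕ × β := fun c i => (c, n c / 2 ^ i, (step c)^[i] (init c))
  have hbody : PolyTime (fun x : γ × ℕ × β => (x.1, x.2.1 / 2, step x.1 x.2.2)) := by
    have : PolyTime (fun x : γ × ℕ × β => step x.1 x.2.2) :=
      hs.comp (f := fun x : γ × ℕ × β => (x.1, x.2.2)) (by fun_prop)
    fun_prop
  have hloop := PolyTimeOn.loop (D := Set.univ) (n := fun c => Nat.size (n c)) (s := s)
    (t := fun x => x.2.1) (B := fun c => bits c + (bits (n c) + B c + 1) + 1)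
    (by fun_prop) hbody
    (by
      have : PolyTime (fun c => s c 0) := by 
        simp only [s, pow_zero, Nat.div_one, Function.iterate_zero, id_eq]
        fun_prop
      exact this)
    ((hn.bdd _).mono fun c _ => by rw [bits_nat]; omega)
    ((PolyBdd.bits.add (((hn.bdd _).add hB).add (.const 1))).add (.const 1))
    (fun c _ i _ => by
      have h1 := hsB c i
      have h2 := bits_nat_mono (Nat.div_le_self (n c) (2 ^ i))
      simp only [s, bits_pair]
      omega)
    (fun c _ i hi => by
      refine ⟨trivial, ?_, ?_⟩
      · exact (Nat.div_pos (Nat.lt_size.1 hi) (by positivity)).ne'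
      · simp only [s, Function.iterate_succ_apply', Nat.div_div_eq_div_mul, pow_succ])
    (fun c _ => Nat.div_eq_of_lt (Nat.lt_size_self _))
  exact (PolyTime.on (f := fun x : γ × ℕ × β => x.2.2) (by fun_prop) Set.univ).comp hloop
    fun _ _ => trivial

end PolyTime

end Lists

/-! ### The algorithms -/

/-- The jobs with their deadlines cut off at the end of the timeline. -/
def clip (N : ℕ) (jobs : List Job) : List Job :=
  jobs.map fun j => ⟨j.release, min j.deadline N, j.processing⟩

/-- The total processing time of the jobs with job interval inside `[a, b]`. -/
def load (a b : ℕ) (jobs : List Job) : ℕ :=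
  (jobs.map fun j =>
    if a ≤ j.release then if j.deadline ≤ b then j.processing else 0 else 0).sum

/-- The number of slots of `[a, b]` outside the pairwise disjoint half-open intervals in `L`. -/
def free (L : List (ℕ × ℕ)) (a b : ℕ) : ℕ :=
  (b + 1 - a) - (L.map fun I => min (b + 1) I.2 - max a I.1).sum

/-- The largest processing time, up to that of `j`, that the job interval of `j` admits outside
`L` besides the jobs `acc`, by Hall's condition for the intervals spanned by `jobs`. -/
def room (L : List (ℕ × ℕ)) (jobs acc : List Job) (j : Job) : ℕ :=
  (jobs.flatMap fun u => jobs.map fun v =>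
    if u.release ≤ j.release then
      if j.deadline ≤ v.deadline then
        free L u.release v.deadline - load u.release v.deadline acc
      else j.processing
    else j.processing).foldl min j.processing

/-- Adds the job `j`, with its processing time reduced to what still fits outside `L`. -/
def reduceStep (L : List (ℕ × ℕ)) (jobs acc : List Job) (j : Job) : List Job :=
  ⟨j.release, j.deadline, room L jobs acc j⟩ :: acc

/-- The jobs, in reverse order, with processing times reduced greedily to a maximal vector of
processing times that can be scheduled outside `L`. -/
def reduce (L : List (ℕ × ℕ)) (jobs : List Job) : List Job :=
  jobs.foldl (reduceStep L jobs) []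

/-- Jobs that make an agent busy during the intervals in `L`. -/
def blocks (L : List (ℕ × ℕ)) : List Job :=
  L.map fun I => ⟨I.1, I.2 - 1, I.2 - I.1⟩

/-- Jobs of an agent whose agreement with a set of slots is the gain in agreement of the original
agent when this set is added to the slots in `L`. -/
def residual (N : ℕ) (L : List (ℕ × ℕ)) (jobs : List Job) : List Job :=
  blocks L ++ (reduce L (clip N jobs)).flatMap fun j => if 1 ≤ j.processing then [j] else []

/-- Merges the interval `J` into the first component if they meet, and keeps it apart
otherwise. -/
def insertStep (x : (ℕ × ℕ) × List (ℕ × ℕ)) (J : ℕ × ℕ) : (ℕ × ℕ) × List (ℕ × ℕ) :=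
  if J.2 ≤ x.1.1 then (x.1, J :: x.2)
  else if x.1.2 ≤ J.1 then (x.1, J :: x.2)
  else ((min x.1.1 J.1, max x.1.2 J.2), x.2)

/-- Adds the half-open interval `[s, e)` to a list of pairwise disjoint intervals. -/
def insertInterval (s e : ℕ) (L : List (ℕ × ℕ)) : List (ℕ × ℕ) :=
  (L.foldl insertStep ((s, e), [])).1 :: (L.foldl insertStep ((s, e), [])).2

/-- The total processing time, over all agents, that can be scheduled outside `[t, t + l)`. Up to a
constant, this is the total agreement with `[t, t + l)`. -/
def score (N : ℕ) (agents : List (List Job)) (l t : ℕ) : ℕ :=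
  (agents.map fun jobs =>
    ((reduce [(t, t + l)] (clip N jobs)).map fun j => j.processing).sum).sum

/-- One round of binary search for a maximum of `score` in an interval on which it is concave. -/
def searchStep (N : ℕ) (agents : List (List Job)) (l : ℕ) (x : ℕ × ℕ) : ℕ × ℕ :=
  if x.1 + 1 ≤ x.2 then
    if score N agents l ((x.1 + x.2) / 2) + 1 ≤ score N agents l ((x.1 + x.2) / 2 + 1) then
      ((x.1 + x.2) / 2 + 1, x.2)
    else (x.1, (x.1 + x.2) / 2)
  else x

/-- Binary search for a maximum of `score` in the interval `[lo, hi]`. -/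
def search (N : ℕ) (agents : List (List Job)) (l lo hi : ℕ) : ℕ :=
  ((searchStep N agents l)^[Nat.size (hi - lo)] (lo, hi)).1

/-- The slots at which job intervals begin or have just ended. -/
def breaks (agents : List (List Job)) : List ℕ :=
  agents.flatMap fun jobs => jobs.flatMap fun j => [j.release, j.deadline + 1]

/-- Start slots of an event of length `l` for which the event begins or has just ended at a
breakpoint, moved into the range of the admissible start slots. -/
def candidates (N : ℕ) (agents : List (List Job)) (l : ℕ) : List ℕ :=
  (1 :: (breaks agents).flatMap fun b => [b, b - l]).map fun c => max 1 (min c (N + 1 - l))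

/-- The last slot before the next entry of `cs` after `c`, or `M`. -/
def pieceEnd (M : ℕ) (cs : List ℕ) (c : ℕ) : ℕ :=
  (cs.map fun b => if b ≤ c then M + 1 else b).foldl min (M + 1) - 1

/-- A best start slot for a single event of length `l`. -/
def bestStart (N : ℕ) (agents : List (List Job)) (l : ℕ) : ℕ :=
  ((candidates N agents l).map fun c =>
    search N agents l c (pieceEnd (N + 1 - l) (candidates N agents l) c)).foldl
    (fun t u => if score N agents l t + 1 ≤ score N agents l u then u else t) 1

/-- An exact algorithm for inputs with one event. -/
def solveOne (I : Instance) : List ℕ := [bestStart I.horizon I.agents I.events.headI]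

namespace PolyTime

variable {γ : Type} [Data γ]

@[fun_prop]
theorem clip {N : γ → ℕ} {J : γ → List Job} (hN : PolyTime N) (hJ : PolyTime J) :
    PolyTime (fun c => PSBA.clip (N c) (J c)) := by
  unfold PSBA.clip
  fun_prop

@[fun_prop]
theorem load {a b : γ → ℕ} {J : γ → List Job} (ha : PolyTime a) (hb : PolyTime b)
    (hJ : PolyTime J) : PolyTime (fun c => PSBA.load (a c) (b c) (J c)) := by
  unfold PSBA.load
  fun_prop

@[fun_prop]
theorem free {L : γ → List (ℕ × ℕ)} {a b : γ → ℕ} (hL : PolyTime L) (ha : PolyTime a)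
    (hb : PolyTime b) : PolyTime (fun c => PSBA.free (L c) (a c) (b c)) := by
  unfold PSBA.free
  fun_prop

@[fun_prop]
theorem room {L : γ → List (ℕ × ℕ)} {J A : γ → List Job} {j : γ → Job} (hL : PolyTime L)
    (hJ : PolyTime J) (hA : PolyTime A) (hj : PolyTime j) :
    PolyTime (fun c => PSBA.room (L c) (J c) (A c) (j c)) := by
  unfold PSBA.room
  fun_prop

end PolyTime

theorem foldl_min_le_init (l : List ℕ) (m : ℕ) : l.foldl min m ≤ m := by
  induction l generalizing m with
  | nil => exact le_rfl
  | cons a l ih => exact (ih _).trans (min_le_left _ _)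

theorem room_le (L : List (ℕ × ℕ)) (jobs acc : List Job) (j : Job) :
    room L jobs acc j ≤ j.processing := foldl_min_le_init _ _

namespace PolyTime

variable {γ : Type} [Data γ]

@[fun_prop]
theorem reduce {L : γ → List (ℕ × ℕ)} {J : γ → List Job} (hL : PolyTime L) (hJ : PolyTime J) :
    PolyTime (fun c => PSBA.reduce (L c) (J c)) := by
  refine foldl_of_add (g := fun x => bits x) hJ (const _) ?_ .bits fun c b a => ?_
  · unfold reduceStep
    fun_prop
  · have := bits_nat_mono (room_le (L c) (J c) b a)
    rw [reduceStep, bits_cons, bits_pair, bits_job, bits_job a]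
    have := one_le_bits c
    dsimp only
    omega

@[fun_prop]
theorem blocks {L : γ → List (ℕ × ℕ)} (hL : PolyTime L) :
    PolyTime (fun c => PSBA.blocks (L c)) := by
  unfold PSBA.blocks
  fun_prop

@[fun_prop]
theorem residual {N : γ → ℕ} {L : γ → List (ℕ × ℕ)} {J : γ → List Job} (hN : PolyTime N)
    (hL : PolyTime L) (hJ : PolyTime J) :
    PolyTime (fun c => PSBA.residual (N c) (L c) (J c)) := by
  unfold PSBA.residual
  fun_prop

theorem bits_insertStep_le (x : (ℕ × ℕ) × List (ℕ × ℕ)) (J : ℕ × ℕ) :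
    bits (insertStep x J) ≤ bits x + (bits J + 1) := by
  obtain ⟨⟨a, b⟩, l⟩ := x
  obtain ⟨c, d⟩ := J
  unfold insertStep
  have h1 : bits (min a c) ≤ bits a := bits_nat_mono (min_le_left _ _)
  have h2 : bits (max b d) ≤ bits b + bits d := by
    rcases max_choice b d with h | h <;> rw [h] <;> omega
  split_ifs <;> simp only [bits_pair, bits_cons] <;> omega

theorem bits_foldl_insertStep_le (L : List (ℕ × ℕ)) (x : (ℕ × ℕ) × List (ℕ × ℕ)) :
    bits (L.foldl insertStep x) ≤ bits x + bits L := by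
  induction L generalizing x with
  | nil => simp
  | cons J L ih =>
    have h1 := ih (insertStep x J)
    have h2 := bits_insertStep_le x J
    rw [List.foldl_cons, bits_cons]
    omega

theorem bits_insertInterval_le (s e : ℕ) (L : List (ℕ × ℕ)) :
    bits (insertInterval s e L) ≤ bits L + (bits s + bits e + 3) := by
  have h := bits_foldl_insertStep_le L ((s, e), [])
  rw [show bits (L.foldl insertStep ((s, e), [])) = bits (L.foldl insertStep ((s, e), [])).1 +
    bits (L.foldl insertStep ((s, e), [])).2 + 1 from rfl] at h
  rw [bits_pair (s, e), bits_pair s e, bits_nil] at h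
  rw [insertInterval, bits_cons]
  omega

@[fun_prop]
theorem insertInterval {s e : γ → ℕ} {L : γ → List (ℕ × ℕ)} (hs : PolyTime s) (he : PolyTime e)
    (hL : PolyTime L) : PolyTime (fun c => PSBA.insertInterval (s c) (e c) (L c)) := by
  have h : PolyTime (fun c => (L c).foldl insertStep ((s c, e c), [])) := by
    refine foldl_of_add (g := fun x => bits x + 1) (step := fun _ => insertStep) hL
      (by fun_prop) ?_ (PolyBdd.bits.add (.const 1)) fun c b a => ?_
    · unfold insertStep
      fun_prop
    · have := bits_insertStep_le b a
      rw [bits_pair c a]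
      omega
  unfold PSBA.insertInterval
  fun_prop

@[fun_prop]
theorem score {N : γ → ℕ} {A : γ → List (List Job)} {l t : γ → ℕ} (hN : PolyTime N)
    (hA : PolyTime A) (hl : PolyTime l) (ht : PolyTime t) :
    PolyTime (fun c => PSBA.score (N c) (A c) (l c) (t c)) := by
  unfold PSBA.score
  fun_prop

theorem iterate_searchStep_le (N : ℕ) (A : List (List Job)) (l lo hi i : ℕ) :
    ((searchStep N A l)^[i] (lo, hi)).1 ≤ max lo hi ∧
      ((searchStep N A l)^[i] (lo, hi)).2 ≤ max lo hi := by
  induction i with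
  | zero => simp
  | succ i ih =>
    rw [Function.iterate_succ_apply']
    generalize (searchStep N A l)^[i] (lo, hi) = x at ih ⊢
    unfold searchStep
    split_ifs <;> try dsimp only
    all_goals omega

@[fun_prop]
theorem search {N : γ → ℕ} {A : γ → List (List Job)} {l lo hi : γ → ℕ} (hN : PolyTime N)
    (hA : PolyTime A) (hl : PolyTime l) (hlo : PolyTime lo) (hhi : PolyTime hi) :
    PolyTime (fun c => PSBA.search (N c) (A c) (l c) (lo c) (hi c)) := by
  have hm : PolyTime (fun c => max (lo c) (hi c)) := by fun_prop
  have h : PolyTime (fun c =>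
      (searchStep (N c) (A c) (l c))^[Nat.size (hi c - lo c)] (lo c, hi c)) := by
    refine iterate_size (B := fun c => bits (max (lo c) (hi c)) + bits (max (lo c) (hi c)) + 1)
      (by fun_prop) (by fun_prop) ?_ (((hm.bdd _).add (hm.bdd _)).add (.const 1)) fun c i => ?_
    · unfold searchStep
      fun_prop
    · have h := iterate_searchStep_le (N c) (A c) (l c) (lo c) (hi c) i
      have h1 := bits_nat_mono h.1
      have h2 := bits_nat_mono h.2
      generalize (searchStep (N c) (A c) (l c))^[i] (lo c, hi c) = x at h1 h2 ⊢
      rw [show bits x = bits x.1 + bits x.2 + 1 from rfl]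
      omega
  unfold PSBA.search
  fun_prop

@[fun_prop]
theorem candidates {N : γ → ℕ} {A : γ → List (List Job)} {l : γ → ℕ} (hN : PolyTime N)
    (hA : PolyTime A) (hl : PolyTime l) :
    PolyTime (fun c => PSBA.candidates (N c) (A c) (l c)) := by
  unfold PSBA.candidates breaks
  fun_prop

@[fun_prop]
theorem pieceEnd {M : γ → ℕ} {cs : γ → List ℕ} {x : γ → ℕ} (hM : PolyTime M)
    (hcs : PolyTime cs) (hx : PolyTime x) :
    PolyTime (fun c => PSBA.pieceEnd (M c) (cs c) (x c)) := by
  unfold PSBA.pieceEnd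
  fun_prop

@[fun_prop]
theorem bestStart {N : γ → ℕ} {A : γ → List (List Job)} {l : γ → ℕ} (hN : PolyTime N)
    (hA : PolyTime A) (hl : PolyTime l) :
    PolyTime (fun c => PSBA.bestStart (N c) (A c) (l c)) := by
  unfold PSBA.bestStart
  refine foldl_of_add (g := fun x => bits x) ?_ (const _) ?_ .bits fun c b a => ?_
  · fun_prop
  · fun_prop
  · rw [bits_pair]
    split_ifs <;> omega

theorem solveOne : PolyTime PSBA.solveOne := by
  unfold PSBA.solveOne
  fun_prop

end PolyTime

/-! ### A min-max formula for the agreement -/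

/-- The slots of the timeline in which a job may be processed. -/
def window (N : ℕ) (j : Job) : Finset ℕ := Finset.Icc 1 N ∩ Finset.Icc j.release j.deadline

/-- The total processing time of the jobs that can only be processed in `S`. -/
def demand (N : ℕ) (jobs : List Job) (S : Finset ℕ) : ℕ :=
  (jobs.map fun j => if window N j ⊆ S then j.processing else 0).sum

/-- The jobs have a feasible schedule. -/
def Feasible (N : ℕ) (jobs : List Job) : Prop := ∃ σ, IsJobSchedule N jobs σ

section Demand

variable {N : ℕ} {jobs : List Job} {S T : Finset ℕ}

theorem demand_nil : demand N [] S = 0 := rfl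

theorem demand_cons (j : Job) : demand N (j :: jobs) S =
    (if window N j ⊆ S then j.processing else 0) + demand N jobs S := by
  simp [demand]

theorem demand_append (J K : List Job) : demand N (J ++ K) S = demand N J S + demand N K S := by
  simp [demand]

theorem demand_mono (h : S ⊆ T) : demand N jobs S ≤ demand N jobs T := by
  induction jobs with
  | nil => simp [demand_nil]
  | cons j jobs ih =>
    rw [demand_cons, demand_cons]
    split_ifs with h1 h2
    · omega
    · exact absurd (h1.trans h) h2
    · omega
    · omega

theorem demand_add_le : demand N jobs S + demand N jobs T ≤
    demand N jobs (S ∪ T) + demand N jobs (S ∩ T) := by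
  induction jobs with
  | nil => simp [demand_nil]
  | cons j jobs ih =>
    simp only [demand_cons, Finset.subset_inter_iff]
    have h1 : window N j ⊆ S → window N j ⊆ S ∪ T := fun h => h.trans Finset.subset_union_left
    have h2 : window N j ⊆ T → window N j ⊆ S ∪ T := fun h => h.trans Finset.subset_union_right
    by_cases hS : window N j ⊆ S <;> by_cases hT : window N j ⊆ T <;> simp [hS, hT, h1, h2] <;>
      omega

theorem demand_eq_sum : demand N jobs S =
    ∑ i : Fin jobs.length, if window N (jobs.get i) ⊆ S then (jobs.get i).processing else 0 := by
  rw [demand, ← Fin.sum_univ_fun_getElem]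
  rfl

end Demand

section Agreement

variable {N : ℕ} {jobs : List Job} {S T X Y : Finset ℕ}

/-- The easy half of the min-max formula: the jobs counted by `demand` fill slots of `S`. -/
theorem IsJobSchedule.card_add_demand_le {σ : Fin jobs.length → Finset ℕ}
    (h : IsJobSchedule N jobs σ) (X S : Finset ℕ) :
    (X \ Finset.univ.biUnion σ).card + demand N jobs S ≤ (X ∪ S).card := by
  let J := Finset.univ.filter fun i : Fin jobs.length => window N (jobs.get i) ⊆ S
  have h1 : demand N jobs S = (J.biUnion σ).card := by
    rw [Finset.card_biUnion fun i _ j _ hij => h.2 i j hij, demand_eq_sum, Finset.sum_filter]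
    refine Finset.sum_congr rfl fun i _ => ?_
    rw [(h.1 i).2]
  have h2 : Disjoint (X \ Finset.univ.biUnion σ) (J.biUnion σ) :=
    Finset.disjoint_sdiff.symm.mono_right
      (Finset.biUnion_subset_biUnion_of_subset_left _ (Finset.subset_univ _))
  rw [h1, ← Finset.card_union_of_disjoint h2]
  refine Finset.card_le_card (Finset.union_subset_union Finset.sdiff_subset ?_)
  refine Finset.biUnion_subset.2 fun i hi => ?_
  exact ((h.1 i).1).trans (Finset.mem_filter.1 hi).2

/-- The hard half of the min-max formula: Hall's theorem for the units of the jobs and `D` further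
units that are to be placed in `X`. -/
theorem exists_schedule {D : ℕ} (h0 : ∀ S, demand N jobs S ≤ S.card)
    (hX : ∀ S, D + demand N jobs S ≤ (X ∪ S).card) :
    ∃ σ, IsJobSchedule N jobs σ ∧ D ≤ (X \ Finset.univ.biUnion σ).card := by
  let t : (Σ i : Fin jobs.length, Fin (jobs.get i).processing) ⊕ Fin D → Finset ℕ :=
    Sum.elim (fun u => window N (jobs.get u.1)) fun _ => X
  have hall : ∀ A : Finset ((Σ i : Fin jobs.length, Fin (jobs.get i).processing) ⊕ Fin D),
      A.card ≤ (A.biUnion t).card := by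
    intro A
    let S := A.toLeft.biUnion fun u => window N (jobs.get u.1)
    have hl : A.toLeft.card ≤ demand N jobs S := by
      have hsub : A.toLeft ⊆ (Finset.univ.filter fun i : Fin jobs.length =>
          window N (jobs.get i) ⊆ S).sigma fun _ => Finset.univ := fun u hu =>
        Finset.mem_sigma.2 ⟨Finset.mem_filter.2 ⟨Finset.mem_univ _,
          Finset.subset_biUnion_of_mem
            (fun u : Σ i : Fin jobs.length, Fin (jobs.get i).processing =>
              window N (jobs.get u.1)) hu⟩, Finset.mem_univ _⟩
      refine (Finset.card_le_card hsub).trans (le_of_eq ?_)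
      rw [Finset.card_sigma, demand_eq_sum, Finset.sum_filter]
      refine Finset.sum_congr rfl fun i _ => ?_
      rw [Finset.card_univ, Fintype.card_fin]
    have hS : S ⊆ A.biUnion t := by
      refine Finset.biUnion_subset.2 fun u hu => ?_
      exact Finset.subset_biUnion_of_mem t (Finset.mem_toLeft.1 hu)
    rw [← Finset.card_toLeft_add_card_toRight]
    rcases A.toRight.eq_empty_or_nonempty with hr | ⟨d, hd⟩
    · rw [hr, Finset.card_empty, add_zero]
      exact (hl.trans (h0 S)).trans (Finset.card_le_card hS)
    · have hr : A.toRight.card ≤ D := (Finset.card_le_univ _).trans_eq (Fintype.card_fin D)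
      have hXS : X ∪ S ⊆ A.biUnion t :=
        Finset.union_subset (Finset.subset_biUnion_of_mem t (Finset.mem_toRight.1 hd)) hS
      have := hX S
      have := Finset.card_le_card hXS
      omega
  obtain ⟨f, hf, hft⟩ := (Finset.all_card_le_biUnion_card_iff_exists_injective t).1 hall
  refine ⟨fun i => Finset.univ.image fun k => f (.inl ⟨i, k⟩), ⟨fun i => ⟨?_, ?_⟩, ?_⟩, ?_⟩
  · intro x hx
    obtain ⟨k, -, rfl⟩ := Finset.mem_image.1 hx
    exact hft (.inl ⟨i, k⟩)
  · rw [Finset.card_image_of_injective, Finset.card_univ, Fintype.card_fin]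
    intro k l hkl
    simpa using hf hkl
  · intro i j hij
    rw [Finset.disjoint_left]
    intro x hx hy
    obtain ⟨k, -, rfl⟩ := Finset.mem_image.1 hx
    obtain ⟨l, -, h⟩ := Finset.mem_image.1 hy
    have := hf h
    simp only [Sum.inl.injEq, Sigma.mk.injEq] at this
    exact hij this.1.symm
  · have hinj : Function.Injective fun d : Fin D => f (.inr d) := fun a b h => by
      simpa using hf h
    have hcard : (Finset.univ.image fun d : Fin D => f (.inr d)).card = D := by
      rw [Finset.card_image_of_injective _ hinj, Finset.card_univ, Fintype.card_fin]
    refine hcard.symm.le.trans (Finset.card_le_card fun x hx => ?_)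
    obtain ⟨d, -, rfl⟩ := Finset.mem_image.1 hx
    refine Finset.mem_sdiff.2 ⟨hft (.inr d), fun h => ?_⟩
    obtain ⟨i, -, hi⟩ := Finset.mem_biUnion.1 h
    obtain ⟨k, -, hk⟩ := Finset.mem_image.1 hi
    exact absurd (hf hk) (by simp)

theorem feasible_iff : Feasible N jobs ↔ ∀ S, demand N jobs S ≤ S.card := by
  constructor
  · rintro ⟨σ, h⟩ S
    simpa using h.card_add_demand_le ∅ S
  · intro h
    obtain ⟨σ, hσ, -⟩ := exists_schedule (X := ∅) (D := 0) h (by simpa using h)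
    exact ⟨σ, hσ⟩

namespace Feasible

theorem agr_spec (h : Feasible N jobs) (X : Finset ℕ) :
    (∀ S, agr N jobs X + demand N jobs S ≤ (X ∪ S).card) ∧
      ∃ S, agr N jobs X + demand N jobs S = (X ∪ S).card := by
  set C : Set ℕ := {c | ∃ σ : Fin jobs.length → Finset ℕ, IsJobSchedule N jobs σ ∧
    c = (X \ Finset.univ.biUnion σ).card} with hC
  have hne : C.Nonempty := by
    obtain ⟨σ, hσ⟩ := h
    exact ⟨_, σ, hσ, rfl⟩
  have hbdd : BddAbove C := by
    refine ⟨X.card, ?_⟩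
    rintro _ ⟨σ, -, rfl⟩
    exact Finset.card_le_card Finset.sdiff_subset
  have hle : ∀ S, agr N jobs X + demand N jobs S ≤ (X ∪ S).card := by
    obtain ⟨σ, hσ, hc⟩ := Nat.sSup_mem hne hbdd
    intro S
    have := hσ.card_add_demand_le X S
    rwa [← hc] at this
  refine ⟨hle, ?_⟩
  have hex : ∃ d S, d + demand N jobs S = (X ∪ S).card :=
    ⟨(X ∪ ∅).card - demand N jobs ∅, ∅, Nat.sub_add_cancel (by have := hle ∅; omega)⟩
  classical
  obtain ⟨S, hS⟩ := Nat.find_spec hex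
  have hmin : ∀ S, Nat.find hex + demand N jobs S ≤ (X ∪ S).card := by
    intro S
    have h1 := hle S
    have := Nat.find_min' hex ⟨S, Nat.sub_add_cancel (n := (X ∪ S).card)
      (m := demand N jobs S) (by omega)⟩
    omega
  obtain ⟨σ, hσ, hD⟩ := exists_schedule (feasible_iff.1 h) hmin
  have h1 : (X \ Finset.univ.biUnion σ).card ≤ agr N jobs X := le_csSup hbdd ⟨σ, hσ, rfl⟩
  exact ⟨S, le_antisymm (hle S) (by omega)⟩

theorem agr_add_demand_le (h : Feasible N jobs) (X S : Finset ℕ) :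
    agr N jobs X + demand N jobs S ≤ (X ∪ S).card := (h.agr_spec X).1 S

theorem agr_empty (h : Feasible N jobs) : agr N jobs ∅ = 0 := by
  have := h.agr_add_demand_le ∅ ∅
  simp only [Finset.union_empty, Finset.card_empty] at this
  omega

theorem agr_mono (h : Feasible N jobs) (hXY : X ⊆ Y) : agr N jobs X ≤ agr N jobs Y := by
  obtain ⟨S, hS⟩ := (h.agr_spec Y).2
  have h1 := h.agr_add_demand_le X S
  have h2 := Finset.card_le_card (Finset.union_subset_union_left (t := S) hXY)
  omega

theorem agr_submodular (h : Feasible N jobs) (X Y : Finset ℕ) :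
    agr N jobs (X ∪ Y) + agr N jobs (X ∩ Y) ≤ agr N jobs X + agr N jobs Y := by
  obtain ⟨S, hS⟩ := (h.agr_spec X).2
  obtain ⟨T, hT⟩ := (h.agr_spec Y).2
  have h1 := h.agr_add_demand_le (X ∪ Y) (S ∪ T)
  have h2 := h.agr_add_demand_le (X ∩ Y) (S ∩ T)
  have h3 := demand_add_le (N := N) (jobs := jobs) (S := S) (T := T)
  have h4 := Finset.card_union_add_card_inter (X ∪ S) (Y ∪ T)
  have h5 : (X ∩ Y ∪ S ∩ T).card ≤ ((X ∪ S) ∩ (Y ∪ T)).card :=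
    Finset.card_le_card fun x => by
      simp only [Finset.mem_union, Finset.mem_inter]
      tauto
  have h6 : (X ∪ S) ∪ (Y ∪ T) = (X ∪ Y) ∪ (S ∪ T) := Finset.union_union_union_comm _ _ _ _
  rw [h6] at h4
  omega

theorem agr_insert_le (h : Feasible N jobs) (x : ℕ) (X : Finset ℕ) :
    agr N jobs (insert x X) ≤ agr N jobs X + 1 := by
  obtain ⟨S, hS⟩ := (h.agr_spec X).2
  have h1 := h.agr_add_demand_le (insert x X) S
  rw [Finset.insert_union] at h1
  have h2 := Finset.card_insert_le x (X ∪ S)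
  omega

/-- Slots that lie in the same job intervals are interchangeable. -/
theorem agr_map_swap (h : Feasible N jobs) {x y : ℕ}
    (hxy : ∀ j ∈ jobs, (x ∈ window N j ↔ y ∈ window N j)) (X : Finset ℕ) :
    agr N jobs (X.map (Equiv.swap x y).toEmbedding) = agr N jobs X := by
  set e := (Equiv.swap x y).toEmbedding
  have hw : ∀ j ∈ jobs, (window N j).map e = window N j := by
    intro j hj
    ext z
    have : z ∈ (window N j).map e ↔ Equiv.swap x y z ∈ window N j := by
      rw [Finset.mem_map_equiv, Equiv.symm_swap]
    rw [this]
    rcases eq_or_ne z x with rfl | hx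
    · rw [Equiv.swap_apply_left, hxy j hj]
    · rcases eq_or_ne z y with rfl | hy
      · rw [Equiv.swap_apply_right, hxy j hj]
      · rw [Equiv.swap_apply_of_ne_of_ne hx hy]
  have hd : ∀ S, demand N jobs (S.map e) = demand N jobs S := by
    intro S
    unfold demand
    congr 1
    refine List.map_congr_left fun j hj => ?_
    have : window N j ⊆ S.map e ↔ window N j ⊆ S := by
      conv_lhs => rw [← hw j hj]
      exact Finset.map_subset_map
    simp [this]
  have hle : ∀ X, agr N jobs (X.map e) ≤ agr N jobs X := by
    intro X
    obtain ⟨S, hS⟩ := (h.agr_spec X).2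
    have h1 := h.agr_add_demand_le (X.map e) (S.map e)
    rw [hd, ← Finset.map_union, Finset.card_map] at h1
    omega
  refine le_antisymm (hle X) ?_
  have h2 : (X.map e).map e = X := by
    ext z
    simp [e, Finset.mem_map_equiv]
  conv_lhs => rw [← h2]
  exact hle _

end Feasible

end Agreement

/-! ### Reducing processing times -/

/-- The total processing time. -/
def total (jobs : List Job) : ℕ := (jobs.map fun j => j.processing).sum

theorem total_cons (j : Job) (jobs : List Job) : total (j :: jobs) = j.processing + total jobs := by
  simp [total]

/-- The slots of a list of half-open intervals. -/
def slots (L : List (ℕ × ℕ)) : Finset ℕ := L.toFinset.biUnion fun I => Finset.Ico I.1 I.2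

theorem slots_nil : slots [] = ∅ := rfl

theorem slots_cons (I : ℕ × ℕ) (L : List (ℕ × ℕ)) :
    slots (I :: L) = Finset.Ico I.1 I.2 ∪ slots L := by
  simp [slots, Finset.biUnion_insert]

theorem mem_slots {L : List (ℕ × ℕ)} {x : ℕ} : x ∈ slots L ↔ ∃ I ∈ L, I.1 ≤ x ∧ x < I.2 := by
  simp [slots]

/-- Pairwise disjoint nonempty half-open intervals. -/
def Separated (L : List (ℕ × ℕ)) : Prop :=
  (∀ I ∈ L, I.1 < I.2) ∧ L.Pairwise fun I J => I.2 ≤ J.1 ∨ J.2 ≤ I.1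

theorem Separated.disjoint {I : ℕ × ℕ} {L : List (ℕ × ℕ)} (h : Separated (I :: L)) :
    Disjoint (Finset.Ico I.1 I.2) (slots L) := by
  rw [Finset.disjoint_left]
  intro x hx hx'
  obtain ⟨J, hJ, h1⟩ := mem_slots.1 hx'
  have := (List.pairwise_cons.1 h.2).1 J hJ
  rw [Finset.mem_Ico] at hx
  omega

theorem Separated.tail {I : ℕ × ℕ} {L : List (ℕ × ℕ)} (h : Separated (I :: L)) : Separated L :=
  ⟨fun J hJ => h.1 J (List.mem_cons_of_mem _ hJ), (List.pairwise_cons.1 h.2).2⟩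

theorem free_eq {L : List (ℕ × ℕ)} (h : Separated L) (a b : ℕ) :
    free L a b = (Finset.Icc a b \ slots L).card := by
  have key : (L.map fun I => min (b + 1) I.2 - max a I.1).sum =
      (Finset.Icc a b ∩ slots L).card := by
    induction L with
    | nil => simp [slots_nil]
    | cons I L ih =>
      rw [slots_cons, Finset.inter_union_distrib_left, Finset.card_union_of_disjoint
        (h.disjoint.mono Finset.inter_subset_right Finset.inter_subset_right), List.map_cons,
        List.sum_cons, ih h.tail]
      congr 1
      rw [← Nat.card_Ico]
      congr 1
      ext x
      simp only [Finset.mem_Ico, Finset.mem_inter, Finset.mem_Icc]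
      omega
  rw [free, key, Finset.card_sdiff, Nat.card_Icc, Finset.inter_comm]

/-- The job interval is nonempty and lies inside the timeline. -/
def Proper (N : ℕ) (j : Job) : Prop :=
  1 ≤ j.release ∧ j.release ≤ j.deadline ∧ j.deadline ≤ N

section Reduce

variable {N : ℕ} {jobs acc : List Job} {X S : Finset ℕ}

theorem Proper.window_eq {j : Job} (h : Proper N j) :
    window N j = Finset.Icc j.release j.deadline := by
  obtain ⟨h1, h2, h3⟩ := h
  ext x
  simp only [window, Finset.mem_inter, Finset.mem_Icc]
  omega

theorem Proper.window_subset_iff {j : Job} (h : Proper N j) {a b : ℕ} :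
    window N j ⊆ Finset.Icc a b ↔ a ≤ j.release ∧ j.deadline ≤ b := by
  rw [h.window_eq]
  exact Finset.Icc_subset_Icc_iff h.2.1

theorem load_eq (h : ∀ j ∈ jobs, Proper N j) (a b : ℕ) :
    load a b jobs = demand N jobs (Finset.Icc a b) := by
  unfold load demand
  congr 1
  refine List.map_congr_left fun j hj => ?_
  simp only [(h j hj).window_subset_iff, ite_and]

theorem demand_split {A B : Finset ℕ}
    (h : ∀ j ∈ jobs, window N j ⊆ S → window N j ⊆ A ∨ window N j ⊆ B) :
    demand N jobs S ≤ demand N jobs A + demand N jobs B := by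
  induction jobs with
  | nil => simp [demand_nil]
  | cons j jobs ih =>
    have h1 := ih fun k hk => h k (List.mem_cons_of_mem _ hk)
    have h2 := h j List.mem_cons_self
    simp only [demand_cons]
    by_cases hS : window N j ⊆ S
    · rcases h2 hS with h3 | h3
      · simp only [hS, h3, if_true]
        omega
      · simp only [hS, h3, if_true]
        omega
    · simp only [hS, if_false]
      omega

theorem demand_eq_zero (h : ∀ j ∈ jobs, ¬ window N j ⊆ S) : demand N jobs S = 0 := by
  induction jobs with
  | nil => rfl
  | cons j jobs ih =>
    rw [demand_cons, if_neg (h j List.mem_cons_self),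
      ih fun k hk => h k (List.mem_cons_of_mem _ hk)]

/-- Hall's condition has to be checked only for the intervals spanned by the jobs: from any other
set, split off the interval from the first release time to the last reachable deadline. -/
theorem demand_le_card_sdiff (hp : ∀ j ∈ jobs, Proper N j)
    (h : ∀ u ∈ jobs, ∀ v ∈ jobs, demand N jobs (Finset.Icc u.release v.deadline) ≤
      (Finset.Icc u.release v.deadline \ X).card) (S : Finset ℕ) :
    demand N jobs S ≤ (S \ X).card := by
  induction S using Finset.strongInduction with
  | H S ih =>
    by_cases hS : ∃ j ∈ jobs, window N j ⊆ S
    swap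
    · push Not at hS
      rw [demand_eq_zero hS]
      exact Nat.zero_le _
    have hfin : ∀ p : Job → Prop, {j | j ∈ jobs ∧ p j}.Finite := fun p =>
      (List.finite_toSet jobs).subset fun j hj => hj.1
    -- `u` has the first release time of the jobs inside `S`, and `v` the last deadline that can be
    -- reached from there inside `S`
    obtain ⟨u, ⟨hu, huS⟩, humin⟩ := Set.exists_min_image _ Job.release (hfin _) hS
    obtain ⟨v, ⟨hv, hvS⟩, hvmax⟩ := Set.exists_max_image
      {v | v ∈ jobs ∧ Finset.Icc u.release v.deadline ⊆ S} Job.deadline (hfin _)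
      ⟨u, hu, (hp u hu).window_eq ▸ huS⟩
    set A := Finset.Icc u.release v.deadline with hA
    have huv : u.deadline ≤ v.deadline := hvmax u ⟨hu, (hp u hu).window_eq ▸ huS⟩
    have huA : u.release ∈ A := by
      have := (hp u hu).2.1
      rw [hA, Finset.mem_Icc]
      omega
    have hlt : S \ A ⊂ S :=
      Finset.sdiff_ssubset hvS ⟨_, huA⟩
    have h1 := ih _ hlt
    have h2 : demand N jobs S ≤ demand N jobs A + demand N jobs (S \ A) := by
      refine demand_split fun k hk hkS => ?_
      have hur : u.release ≤ k.release := humin k ⟨hk, hkS⟩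
      rw [(hp k hk).window_eq] at hkS ⊢
      by_cases hkv : k.release ≤ v.deadline
      · left
        refine Finset.Icc_subset_Icc hur (hvmax k ⟨hk, fun x hx => ?_⟩)
        rw [Finset.mem_Icc] at hx
        by_cases hxv : x ≤ v.deadline
        · exact hvS (Finset.mem_Icc.2 ⟨hx.1, hxv⟩)
        · exact hkS (Finset.mem_Icc.2 ⟨by omega, hx.2⟩)
      · right
        intro x hx
        refine Finset.mem_sdiff.2 ⟨hkS hx, fun hxA => ?_⟩
        rw [hA, Finset.mem_Icc] at hxA
        rw [Finset.mem_Icc] at hx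
        omega
    have h3 : demand N jobs A ≤ (A \ X).card := h u hu v hv
    have h4 : (A \ X).card + ((S \ A) \ X).card = (S \ X).card := by
      rw [← Finset.card_union_of_disjoint
        ((Finset.disjoint_sdiff (s := A) (t := S)).mono Finset.sdiff_subset Finset.sdiff_subset),
        ← Finset.union_sdiff_distrib, Finset.union_sdiff_of_subset hvS]
    omega

theorem foldl_min_le {l : List ℕ} {m x : ℕ} (h : x ∈ l) : l.foldl min m ≤ x := by
  induction l generalizing m with
  | nil => simp at h
  | cons a l ih =>
    rcases List.mem_cons.1 h with rfl | h
    · exact (foldl_min_le_init l (min m x)).trans (min_le_right _ _)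
    · exact ih h

theorem foldl_min_mem (l : List ℕ) (m : ℕ) : l.foldl min m = m ∨ l.foldl min m ∈ l := by
  induction l generalizing m with
  | nil => exact .inl rfl
  | cons a l ih =>
    rw [List.foldl_cons]
    rcases ih (min m a) with h | h
    · rcases min_choice m a with h' | h'
      · exact .inl (h.trans h')
      · exact .inr (by rw [h, h']; exact List.mem_cons_self)
    · exact .inr (List.mem_cons_of_mem _ h)

theorem room_le_of_subset {L : List (ℕ × ℕ)} {j u v : Job} (hu : u ∈ jobs) (hv : v ∈ jobs)
    (h1 : u.release ≤ j.release) (h2 : j.deadline ≤ v.deadline) :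
    room L jobs acc j ≤ free L u.release v.deadline - load u.release v.deadline acc := by
  refine foldl_min_le (List.mem_flatMap.2 ⟨u, hu, List.mem_map.2 ⟨v, hv, ?_⟩⟩)
  rw [if_pos h1, if_pos h2]

theorem room_eq {L : List (ℕ × ℕ)} {j : Job} (h : room L jobs acc j < j.processing) :
    ∃ u ∈ jobs, ∃ v ∈ jobs, u.release ≤ j.release ∧ j.deadline ≤ v.deadline ∧
      room L jobs acc j = free L u.release v.deadline - load u.release v.deadline acc := by
  rcases foldl_min_mem (jobs.flatMap fun u => jobs.map fun v =>
    if u.release ≤ j.release then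
      if j.deadline ≤ v.deadline then
        free L u.release v.deadline - load u.release v.deadline acc
      else j.processing
    else j.processing) j.processing with h1 | h1
  · exact absurd h1 h.ne
  · obtain ⟨u, hu, h2⟩ := List.mem_flatMap.1 h1
    obtain ⟨v, hv, h3⟩ := List.mem_map.1 h2
    change _ = room L jobs acc j at h3
    split_ifs at h3 with h4 h5
    · exact ⟨u, hu, v, hv, h4, h5, h3.symm⟩
    · exact absurd h3 h.ne'
    · exact absurd h3 h.ne'

/-- `acc` arises from `done` by reducing processing times to a maximal vector that can be scheduled
outside `X`. Feasibility is Hall's condition. Maximality is witnessed by a set of slots that is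
used up completely outside `X` and contains the job intervals of all reduced jobs. -/
structure MaximalReduction (N : ℕ) (X : Finset ℕ) (done acc : List Job) : Prop where
  exists_job : ∀ j ∈ acc, ∃ i ∈ done, j.release = i.release ∧ j.deadline = i.deadline
  add_total_le : ∀ S, demand N done S + total acc ≤ demand N acc S + total done
  demand_le : ∀ S, demand N acc S ≤ (S \ X).card
  exists_tight : ∃ K, demand N acc K = (K \ X).card ∧
    ∀ S, K ⊆ S → demand N done S + total acc = demand N acc S + total done

theorem MaximalReduction.snoc {L : List (ℕ × ℕ)} (hL : Separated L) {done : List Job} {j : Job}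
    (hp : ∀ j ∈ jobs, Proper N j) (hdone : done ⊆ jobs) (hj : j ∈ jobs)
    (h : MaximalReduction N (slots L) done acc) :
    MaximalReduction N (slots L) (done ++ [j]) (reduceStep L jobs acc j) := by
  set p := room L jobs acc j with hpdef
  have hpj : p ≤ j.processing := room_le L jobs acc j
  have hacc : ∀ k ∈ acc, Proper N k := fun k hk => by
    obtain ⟨i, hi, h1, h2⟩ := h.exists_job k hk
    have := hp i (hdone hi)
    unfold Proper at *
    rwa [h1, h2]
  have hd : ∀ S, demand N (done ++ [j]) S =
      demand N done S + if window N j ⊆ S then j.processing else 0 := fun S => by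
    rw [demand_append, demand_cons, demand_nil, add_zero]
  have ha : ∀ S, demand N (reduceStep L jobs acc j) S =
      (if window N j ⊆ S then p else 0) + demand N acc S := fun S => by
    rw [reduceStep, demand_cons]
    rfl
  have htd : total (done ++ [j]) = total done + j.processing := by simp [total]
  have hta : total (reduceStep L jobs acc j) = p + total acc := by rw [reduceStep, total_cons]
  have hex : ∀ k ∈ reduceStep L jobs acc j, ∃ i ∈ done ++ [j],
      k.release = i.release ∧ k.deadline = i.deadline := by
    intro k hk
    rcases List.mem_cons.1 hk with rfl | hk
    · exact ⟨j, by simp, rfl, rfl⟩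
    · obtain ⟨i, hi, h1⟩ := h.exists_job k hk
      exact ⟨i, by simp [hi], h1⟩
  have hsub : done ++ [j] ⊆ jobs := by
    intro k hk
    rcases List.mem_append.1 hk with hk | hk
    · exact hdone hk
    · rwa [List.mem_singleton.1 hk]
  have hle : ∀ S, demand N (reduceStep L jobs acc j) S ≤ (S \ slots L).card := by
    refine demand_le_card_sdiff (fun k hk => ?_) fun u hu v hv => ?_
    · obtain ⟨i, hi, h1, h2⟩ := hex k hk
      have := hp i (hsub hi)
      unfold Proper at *
      rwa [h1, h2]
    · obtain ⟨u', hu', h1, -⟩ := hex u hu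
      obtain ⟨v', hv', -, h2⟩ := hex v hv
      rw [h1, h2, ha]
      have h3 := h.demand_le (Finset.Icc u'.release v'.deadline)
      split_ifs with hw
      · rw [(hp j hj).window_subset_iff] at hw
        have h4 := room_le_of_subset (acc := acc) (L := L) (hsub hu') (hsub hv') hw.1 hw.2
        rw [← hpdef, free_eq hL, load_eq hacc] at h4
        omega
      · omega
  refine ⟨hex, fun S => ?_, hle, ?_⟩
  · have := h.add_total_le S
    rw [hd, ha, htd, hta]
    split_ifs <;> omega
  · obtain ⟨K, hK, hKS⟩ := h.exists_tight
    rcases hpj.eq_or_lt with hpe | hlt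
    · refine ⟨K, le_antisymm (hle K) ?_, fun S hS => ?_⟩
      · rw [ha]
        omega
      · have := hKS S hS
        rw [hd, ha, htd, hta]
        split_ifs <;> omega
    · -- the interval that limits the processing time of `j` becomes tight and joins `K`
      obtain ⟨u, hu, v, hv, h1, h2, h3⟩ := room_eq hlt
      set I := Finset.Icc u.release v.deadline with hI
      have hwI : window N j ⊆ I := (hp j hj).window_subset_iff.2 ⟨h1, h2⟩
      rw [← hpdef, free_eq hL, load_eq hacc, ← hI] at h3
      have hIt : demand N (reduceStep L jobs acc j) I = (I \ slots L).card := by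
        have := h.demand_le I
        rw [ha, if_pos hwI]
        omega
      refine ⟨K ∪ I, le_antisymm (hle _) ?_, fun S hS => ?_⟩
      · have h4 := demand_add_le (N := N) (jobs := reduceStep L jobs acc j) (S := K) (T := I)
        have h5 := hle (K ∩ I)
        have h6 : (K \ slots L).card ≤ demand N (reduceStep L jobs acc j) K := by
          rw [ha]
          omega
        have h7 := Finset.card_union_add_card_inter (K \ slots L) (I \ slots L)
        have h8 : (K \ slots L) ∩ (I \ slots L) = (K ∩ I) \ slots L := by
          ext x
          simp only [Finset.mem_inter, Finset.mem_sdiff]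
          tauto
        rw [← Finset.union_sdiff_distrib, h8] at h7
        omega
      · have := hKS S (Finset.subset_union_left.trans hS)
        rw [hd, ha, htd, hta, if_pos (hwI.trans (Finset.subset_union_right.trans hS)),
          if_pos (hwI.trans (Finset.subset_union_right.trans hS))]
        omega

theorem maximalReduction_reduce {L : List (ℕ × ℕ)} (hL : Separated L)
    (hp : ∀ j ∈ jobs, Proper N j) : MaximalReduction N (slots L) jobs (reduce L jobs) := by
  have key : ∀ l, l ⊆ jobs →
      MaximalReduction N (slots L) l (l.foldl (reduceStep L jobs) []) := by
    intro l
    induction l using List.reverseRecOn with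
    | nil => exact fun _ => ⟨by simp, by simp [demand_nil, total], by simp [demand_nil],
        ∅, by simp [demand_nil], by simp [demand_nil, total]⟩
    | append_singleton l j ih =>
      intro h
      rw [List.foldl_append]
      exact (ih fun k hk => h (by simp [hk])).snoc hL hp (fun k hk => h (by simp [hk]))
        (h (by simp))
  exact key jobs (List.Subset.refl _)

end Reduce

/-! ### The gain in agreement as an agreement -/

/-- The standing assumptions on the jobs of an agent. -/
def ValidJobs (N : ℕ) (jobs : List Job) : Prop :=
  (∀ j ∈ jobs, 1 ≤ j.release ∧ 1 ≤ j.deadline ∧ 1 ≤ j.processing ∧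
    j.release + j.processing ≤ j.deadline + 1) ∧ Feasible N jobs

/-- Pairwise disjoint nonempty half-open intervals inside the timeline. -/
structure BusyList (N : ℕ) (L : List (ℕ × ℕ)) : Prop where
  separated : Separated L
  bounds : ∀ I ∈ L, 1 ≤ I.1 ∧ I.2 ≤ N + 1

section Residual

variable {N : ℕ} {jobs : List Job} {L : List (ℕ × ℕ)} {S : Finset ℕ}

theorem processing_le_demand {j : Job} (hj : j ∈ jobs) (h : window N j ⊆ S) :
    j.processing ≤ demand N jobs S := by
  have h1 := List.le_sum_of_mem
    (List.mem_map_of_mem (f := fun j => if window N j ⊆ S then j.processing else 0) hj)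
  rwa [if_pos h] at h1

theorem demand_clip : demand N (clip N jobs) S = demand N jobs S := by
  have h : ∀ j : Job, window N ⟨j.release, min j.deadline N, j.processing⟩ = window N j := by
    intro j
    ext x
    simp only [window, Finset.mem_inter, Finset.mem_Icc]
    omega
  simp [demand, clip, Function.comp_def, h]

theorem total_clip : total (clip N jobs) = total jobs := by
  simp [total, clip, Function.comp_def]

theorem ValidJobs.proper_clip (h : ValidJobs N jobs) : ∀ j ∈ clip N jobs, Proper N j := by
  intro j hj
  obtain ⟨i, hi, rfl⟩ := List.mem_map.1 hj
  have h1 := h.1 i hi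
  have h2 := (processing_le_demand hi (Finset.Subset.refl (window N i))).trans
    (feasible_iff.1 h.2 _)
  obtain ⟨x, hx⟩ := Finset.card_pos.1 (show 0 < (window N i).card by omega)
  simp only [window, Finset.mem_inter, Finset.mem_Icc] at hx
  simp only [Proper]
  omega

/-- The reduced processing times of valid jobs. -/
theorem ValidJobs.maximalReduction (h : ValidJobs N jobs) (hL : Separated L) :
    MaximalReduction N (slots L) (clip N jobs) (reduce L (clip N jobs)) :=
  maximalReduction_reduce hL h.proper_clip

theorem card_union_eq (X S : Finset ℕ) : (X ∪ S).card = X.card + (S \ X).card := by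
  rw [← Finset.union_sdiff_self_eq_union, Finset.card_union_of_disjoint Finset.disjoint_sdiff]

/-- The agreement with a set of slots in terms of the processing times that fit outside. -/
theorem ValidJobs.agr_add_total (h : ValidJobs N jobs) (hL : Separated L) :
    agr N jobs (slots L) + total jobs = (slots L).card + total (reduce L (clip N jobs)) := by
  have hR := h.maximalReduction hL
  obtain ⟨K, hK, hKS⟩ := hR.exists_tight
  obtain ⟨S, hS⟩ := (h.2.agr_spec (slots L)).2
  have h1 := h.2.agr_add_demand_le (slots L) K
  have h2 := hKS K (Finset.Subset.refl K)
  have h3 := hR.add_total_le S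
  have h4 := hR.demand_le S
  rw [demand_clip, total_clip] at h2 h3
  rw [card_union_eq] at h1 hS
  omega

theorem window_block {I : ℕ × ℕ} (hI : I.1 < I.2) (hb : 1 ≤ I.1 ∧ I.2 ≤ N + 1) :
    window N ⟨I.1, I.2 - 1, I.2 - I.1⟩ = Finset.Ico I.1 I.2 := by
  ext x
  simp only [window, Finset.mem_inter, Finset.mem_Icc, Finset.mem_Ico]
  omega

theorem BusyList.tail {I : ℕ × ℕ} (h : BusyList N (I :: L)) : BusyList N L :=
  ⟨h.separated.tail, fun J hJ => h.bounds J (List.mem_cons_of_mem _ hJ)⟩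

theorem BusyList.demand_blocks_le (h : BusyList N L) (S : Finset ℕ) :
    demand N (blocks L) S ≤ (S ∩ slots L).card := by
  induction L with
  | nil => simp [blocks, demand_nil]
  | cons I L ih =>
    have h1 := ih h.tail
    rw [blocks, List.map_cons, demand_cons, slots_cons, Finset.inter_union_distrib_left,
      Finset.card_union_of_disjoint
        (h.separated.disjoint.mono Finset.inter_subset_right Finset.inter_subset_right),
      window_block (h.separated.1 I List.mem_cons_self) (h.bounds I List.mem_cons_self)]
    refine add_le_add ?_ h1
    split_ifs with h2
    · rw [Finset.inter_eq_right.2 h2, Nat.card_Ico]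
    · exact Nat.zero_le _

theorem BusyList.demand_blocks_eq (h : BusyList N L) (hS : slots L ⊆ S) :
    demand N (blocks L) S = (slots L).card := by
  induction L with
  | nil => simp [blocks, demand_nil, slots_nil]
  | cons I L ih =>
    rw [slots_cons] at hS
    have h1 := ih h.tail (Finset.subset_union_right.trans hS)
    rw [blocks, List.map_cons, demand_cons, slots_cons,
      Finset.card_union_of_disjoint h.separated.disjoint,
      window_block (h.separated.1 I List.mem_cons_self) (h.bounds I List.mem_cons_self),
      if_pos (Finset.subset_union_left.trans hS), Nat.card_Ico, ← h1]
    rfl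

theorem demand_residual : demand N (residual N L jobs) S =
    demand N (blocks L) S + demand N (reduce L (clip N jobs)) S := by
  rw [residual, demand_append]
  congr 1
  induction reduce L (clip N jobs) with
  | nil => rfl
  | cons j l ih =>
    rw [List.flatMap_cons, demand_append, ih, demand_cons]
    congr 1
    split_ifs with h1 h2 h2
    · simp [demand_cons, demand_nil, h2]
    · simp [demand_cons, demand_nil, h2]
    · simp only [demand_nil]
      omega
    · rfl

theorem ValidJobs.residual (h : ValidJobs N jobs) (hL : BusyList N L) :
    ValidJobs N (residual N L jobs) := by
  have hR := h.maximalReduction hL.separated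
  refine ⟨fun j hj => ?_, feasible_iff.2 fun S => ?_⟩
  · rcases List.mem_append.1 hj with hj | hj
    · obtain ⟨I, hI, rfl⟩ := List.mem_map.1 hj
      have h1 := hL.separated.1 I hI
      have h2 := hL.bounds I hI
      dsimp only
      omega
    · obtain ⟨i, hi, hj⟩ := List.mem_flatMap.1 hj
      split_ifs at hj with h1
      swap
      · simp at hj
      rw [List.mem_singleton.1 hj]
      obtain ⟨k, hk, h2, h3⟩ := hR.exists_job i hi
      have hp : Proper N i := by
        have := h.proper_clip k hk
        unfold Proper at *
        rwa [h2, h3]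
      have h4 := (processing_le_demand hi (Finset.Subset.refl (window N i))).trans
        ((hR.demand_le _).trans (Finset.card_le_card Finset.sdiff_subset))
      rw [hp.window_eq, Nat.card_Icc] at h4
      unfold Proper at hp
      omega
  · have h1 := hL.demand_blocks_le S
    have h2 := hR.demand_le S
    have h3 := Finset.card_inter_add_card_sdiff S (slots L)
    rw [demand_residual]
    omega

/-- The agreement of the residual jobs is the gain in agreement. -/
theorem ValidJobs.agr_residual (h : ValidJobs N jobs) (hL : BusyList N L) (Y : Finset ℕ) :
    agr N (PSBA.residual N L jobs) Y + agr N jobs (slots L) = agr N jobs (slots L ∪ Y) := by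
  have hR := h.maximalReduction hL.separated
  have hX := h.agr_add_total hL.separated
  have hres := (h.residual hL).2
  set X := slots L
  set R := reduce L (clip N jobs)
  have hdem : ∀ S, demand N (PSBA.residual N L jobs) S =
    demand N (blocks L) S + demand N R S := fun S => demand_residual
  have hble : ∀ S, demand N (blocks L) S ≤ (S ∩ X).card := hL.demand_blocks_le
  have hbeq : ∀ S, X ⊆ S → demand N (blocks L) S = X.card := fun S hS => hL.demand_blocks_eq hS
  apply le_antisymm
  · -- a minimizer `S` for the original jobs gives the upper bound `S ∪ X` for the residual ones
    obtain ⟨S, hS⟩ := (h.2.agr_spec (X ∪ Y)).2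
    have h1 := hres.agr_add_demand_le Y (S ∪ X)
    rw [hdem, hbeq _ Finset.subset_union_right] at h1
    have h2 : demand N R S ≤ demand N R (S ∪ X) := demand_mono Finset.subset_union_left
    have h3 := hR.add_total_le S
    rw [demand_clip, total_clip] at h3
    have h4 : Y ∪ (S ∪ X) = X ∪ Y ∪ S := by
      ext x
      simp only [Finset.mem_union]
      tauto
    rw [h4] at h1
    omega
  · -- conversely a minimizer `S` for the residual jobs is enlarged by a tight set `K`, beyond which
    -- no processing time has been reduced
    obtain ⟨K, hK, hKS⟩ := hR.exists_tight
    obtain ⟨S, hS⟩ := (hres.agr_spec Y).2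
    rw [hdem] at hS
    have h1 := hble S
    have h2 := h.2.agr_add_demand_le (X ∪ Y) (S ∪ K)
    have h3 := hKS (S ∪ K) Finset.subset_union_right
    rw [demand_clip, total_clip] at h3
    have h4 := demand_add_le (N := N) (jobs := R) (S := S) (T := K)
    have h5 := hR.demand_le (S ∩ K)
    have h6 : (X ∪ Y ∪ (S ∪ K)).card ≤ (Y ∪ S).card + (X \ S).card + ((K \ S) \ X).card := by
      refine (Finset.card_le_card fun x => ?_).trans ((Finset.card_union_le
        ((Y ∪ S) ∪ (X \ S)) _).trans (Nat.add_le_add_right (Finset.card_union_le _ _) _))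
      simp only [Finset.mem_union, Finset.mem_sdiff]
      tauto
    have h7 := Finset.card_inter_add_card_sdiff X S
    rw [Finset.inter_comm] at h7
    have h8 : (K \ X).card = ((S ∩ K) \ X).card + ((K \ S) \ X).card := by
      rw [← Finset.card_union_of_disjoint]
      · congr 1
        ext x
        simp only [Finset.mem_union, Finset.mem_sdiff, Finset.mem_inter]
        tauto
      · rw [Finset.disjoint_left]
        intro x
        simp only [Finset.mem_sdiff, Finset.mem_inter]
        tauto
    omega

end Residual

/-! ### Lists of disjoint intervals -/

section Insert

variable {N : ℕ}

theorem busyList_foldl_insertStep (L : List (ℕ × ℕ)) (x : (ℕ × ℕ) × List (ℕ × ℕ))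
    (hx : x.1.1 < x.1.2) (hb : 1 ≤ x.1.1 ∧ x.1.2 ≤ N + 1)
    (hd : ∀ K ∈ x.2, K.2 ≤ x.1.1 ∨ x.1.2 ≤ K.1) (h : BusyList N (x.2 ++ L)) :
    BusyList N ((L.foldl insertStep x).1 :: (L.foldl insertStep x).2) ∧
      slots ((L.foldl insertStep x).1 :: (L.foldl insertStep x).2) =
        slots (x.1 :: x.2) ∪ slots L := by
  induction L generalizing x with
  | nil =>
    rw [List.append_nil] at h
    refine ⟨⟨⟨?_, List.pairwise_cons.2 ⟨fun K hK => (hd K hK).symm, h.separated.2⟩⟩, ?_⟩, ?_⟩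
    · intro I hI
      rcases List.mem_cons.1 hI with rfl | hI
      · exact hx
      · exact h.separated.1 I hI
    · intro I hI
      rcases List.mem_cons.1 hI with rfl | hI
      · exact hb
      · exact h.bounds I hI
    · rw [slots_nil, Finset.union_empty]
      rfl
  | cons J L ih =>
    obtain ⟨I, M⟩ := x
    have hJ : J ∈ M ++ J :: L := by simp
    have hJ1 := h.separated.1 J hJ
    have hJ2 := h.bounds J hJ
    have hpw := List.pairwise_append.1 h.separated.2
    have hkeep : BusyList N ((J :: M) ++ L) := by
      have hperm : (M ++ J :: L).Perm (J :: M ++ L) := List.perm_middle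
      refine ⟨⟨fun K hK => h.separated.1 K (hperm.mem_iff.2 hK), ?_⟩,
        fun K hK => h.bounds K (hperm.mem_iff.2 hK)⟩
      exact (hperm.pairwise_iff fun {a b} h => h.symm).1 h.separated.2
    have hdrop : BusyList N (M ++ L) := by
      have hsub : (M ++ L).Sublist (M ++ J :: L) := (List.sublist_cons_self J L).append_left M
      exact ⟨⟨fun K hK => h.separated.1 K (hsub.subset hK), h.separated.2.sublist hsub⟩,
        fun K hK => h.bounds K (hsub.subset hK)⟩
    rw [List.foldl_cons]
    dsimp only at hx hb hd
    unfold insertStep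
    dsimp only
    split_ifs with h1 h2
    · obtain ⟨h3, h4⟩ := ih (I, J :: M) hx hb (fun K hK => by
        rcases List.mem_cons.1 hK with rfl | hK
        · exact .inl h1
        · exact hd K hK) hkeep
      refine ⟨h3, h4.trans ?_⟩
      simp only [slots_cons]
      ac_rfl
    · obtain ⟨h3, h4⟩ := ih (I, J :: M) hx hb (fun K hK => by
        rcases List.mem_cons.1 hK with rfl | hK
        · exact .inr h2
        · exact hd K hK) hkeep
      refine ⟨h3, h4.trans ?_⟩
      simp only [slots_cons]
      ac_rfl
    · obtain ⟨h3, h4⟩ := ih ((min I.1 J.1, max I.2 J.2), M) (by dsimp only; omega)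
        (by dsimp only; omega) (fun K hK => by
          have h5 := hd K hK
          have h6 := hpw.2.2 K hK J List.mem_cons_self
          have h7 := h.separated.1 K (by simp [hK])
          dsimp only
          omega) hdrop
      refine ⟨h3, h4.trans ?_⟩
      have h5 : Finset.Ico (min I.1 J.1) (max I.2 J.2) =
          Finset.Ico I.1 I.2 ∪ Finset.Ico J.1 J.2 := by
        ext y
        simp only [Finset.mem_union, Finset.mem_Ico]
        omega
      simp only [slots_cons, h5]
      ac_rfl

theorem BusyList.insertInterval {L : List (ℕ × ℕ)} (h : BusyList N L) {s e : ℕ} (hs : 1 ≤ s)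
    (hse : s < e) (he : e ≤ N + 1) : BusyList N (insertInterval s e L) :=
  (busyList_foldl_insertStep L ((s, e), []) hse ⟨hs, he⟩ (by simp) h).1

theorem BusyList.slots_insertInterval {L : List (ℕ × ℕ)} (h : BusyList N L) {s e : ℕ}
    (hs : 1 ≤ s) (hse : s < e) (he : e ≤ N + 1) :
    slots (PSBA.insertInterval s e L) = Finset.Ico s e ∪ slots L := by
  refine (busyList_foldl_insertStep L ((s, e), []) hse ⟨hs, he⟩ (by simp) h).2.trans ?_
  simp [slots_cons, slots_nil]

end Insert

/-! ### A single event -/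

section Concave

variable {N : ℕ} {jobs : List Job}

theorem map_swap_insert {x y : ℕ} {C : Finset ℕ} (hx : x ∉ C) (hy : y ∉ C) :
    (insert x C).map (Equiv.swap x y).toEmbedding = insert y C := by
  ext z
  rw [Finset.mem_map_equiv, Equiv.symm_swap, Finset.mem_insert, Finset.mem_insert]
  rcases eq_or_ne z x with rfl | h1
  · rw [Equiv.swap_apply_left]
    tauto
  · rcases eq_or_ne z y with rfl | h2
    · rw [Equiv.swap_apply_right]
      tauto
    · rw [Equiv.swap_apply_of_ne_of_ne h1 h2]
      tauto

theorem Feasible.agr_insert_congr (h : Feasible N jobs) {x y : ℕ} {C : Finset ℕ}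
    (hxy : ∀ j ∈ jobs, (x ∈ window N j ↔ y ∈ window N j)) (hx : x ∉ C) (hy : y ∉ C) :
    agr N jobs (insert x C) = agr N jobs (insert y C) := by
  rw [← map_swap_insert hx hy, h.agr_map_swap hxy]

/-- Submodularity for adding two elements. -/
theorem Feasible.agr_insert_insert_le (h : Feasible N jobs) (x y : ℕ) (C : Finset ℕ) :
    agr N jobs (insert x (insert y C)) + agr N jobs C ≤
      agr N jobs (insert x C) + agr N jobs (insert y C) := by
  have h1 := h.agr_submodular (insert x C) (insert y C)
  have h2 : insert x C ∪ insert y C = insert x (insert y C) := by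
    ext z
    simp only [Finset.mem_union, Finset.mem_insert]
    tauto
  have h3 : agr N jobs C ≤ agr N jobs (insert x C ∩ insert y C) :=
    h.agr_mono (Finset.subset_inter (Finset.subset_insert _ _) (Finset.subset_insert _ _))
  rw [h2] at h1
  omega

/-- As an interval of fixed length moves while its two ends stay between breakpoints, the agreement
is a concave function of its position: the slots that leave are interchangeable, and so are the
slots that enter. -/
theorem Feasible.agr_concave (h : Feasible N jobs) {t l : ℕ} (hl : 1 ≤ l)
    (h1 : ∀ j ∈ jobs, (t ∈ window N j ↔ t + 1 ∈ window N j))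
    (h2 : ∀ j ∈ jobs, (t + l ∈ window N j ↔ t + l + 1 ∈ window N j)) :
    agr N jobs (Finset.Ico t (t + l)) + agr N jobs (Finset.Ico (t + 2) (t + 2 + l)) ≤
      2 * agr N jobs (Finset.Ico (t + 1) (t + 1 + l)) := by
  rcases hl.eq_or_lt with rfl | hl
  · have e1 := h.agr_insert_congr (C := ∅) h1 (by simp) (by simp)
    have e2 := h.agr_insert_congr (C := ∅) h2 (by simp) (by simp)
    have e : ∀ s, Finset.Ico s (s + 1) = insert s ∅ := fun s => by simp
    rw [e, e, e, e1]
    rw [show t + 2 = t + 1 + 1 from rfl, ← e2]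
    omega
  · set C := Finset.Ico (t + 2) (t + l)
    have hC : ∀ z, z ∈ C ↔ t + 2 ≤ z ∧ z < t + l := fun z => Finset.mem_Ico
    have e20 : Finset.Ico t (t + l) = insert t (insert (t + 1) C) := by
      ext z
      simp only [Finset.mem_Ico, Finset.mem_insert, hC]
      omega
    have e11 : Finset.Ico (t + 1) (t + 1 + l) = insert (t + l) (insert (t + 1) C) := by
      ext z
      simp only [Finset.mem_Ico, Finset.mem_insert, hC]
      omega
    have e02 : Finset.Ico (t + 2) (t + 2 + l) = insert (t + l) (insert (t + l + 1) C) := by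
      ext z
      simp only [Finset.mem_Ico, Finset.mem_insert, hC]
      omega
    rw [e20, e11, e02]
    -- one leaving slot, one entering slot, and one of each
    have s10 : agr N jobs (insert t C) = agr N jobs (insert (t + 1) C) :=
      h.agr_insert_congr h1 (by rw [hC]; omega) (by rw [hC]; omega)
    have s01 : agr N jobs (insert (t + l) C) = agr N jobs (insert (t + l + 1) C) :=
      h.agr_insert_congr h2 (by rw [hC]; omega) (by rw [hC]; omega)
    have s11 : agr N jobs (insert t (insert (t + l) C)) =
        agr N jobs (insert (t + 1) (insert (t + l) C)) :=
      h.agr_insert_congr h1 (by rw [Finset.mem_insert, hC]; omega)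
        (by rw [Finset.mem_insert, hC]; omega)
    have s11' : agr N jobs (insert (t + l) (insert (t + 1) C)) =
        agr N jobs (insert (t + l + 1) (insert (t + 1) C)) :=
      h.agr_insert_congr h2 (by rw [Finset.mem_insert, hC]; omega)
        (by rw [Finset.mem_insert, hC]; omega)
    have c11 : insert (t + 1) (insert (t + l) C) = insert (t + l) (insert (t + 1) C) :=
      Finset.insert_comm _ _ _
    rw [c11] at s11
    have i20 := h.agr_insert_insert_le t (t + 1) C
    have i02 := h.agr_insert_insert_le (t + l) (t + l + 1) C
    have i21 := h.agr_insert_insert_le t (t + 1) (insert (t + l) C)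
    have i12 := h.agr_insert_insert_le (t + l) (t + l + 1) (insert (t + 1) C)
    rw [c11] at i21
    have m20 : agr N jobs (insert t (insert (t + 1) C)) ≤
        agr N jobs (insert t (insert (t + l) (insert (t + 1) C))) :=
      h.agr_mono (Finset.insert_subset_insert _ (Finset.subset_insert _ _))
    have m02 : agr N jobs (insert (t + l) (insert (t + l + 1) C)) ≤
        agr N jobs (insert (t + l) (insert (t + l + 1) (insert (t + 1) C))) :=
      h.agr_mono (Finset.insert_subset_insert _ (Finset.insert_subset_insert _
        (Finset.subset_insert _ _)))
    have u10 := h.agr_insert_le (t + 1) C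
    have u20 := h.agr_insert_le t (insert (t + 1) C)
    have u01 := h.agr_insert_le (t + l + 1) C
    have u02 := h.agr_insert_le (t + l) (insert (t + l + 1) C)
    have n11 : agr N jobs C ≤ agr N jobs (insert (t + l) (insert (t + 1) C)) :=
      h.agr_mono ((Finset.subset_insert _ _).trans (Finset.subset_insert _ _))
    -- relative to `C` all values are `0`, `1` or `2`, and it matters that they are integers
    omega

end Concave

section Search

theorem le_of_concave_of_le {g : ℕ → ℕ} {c h m : ℕ}
    (hg : ∀ t, c ≤ t → t + 2 ≤ h → g t + g (t + 2) ≤ 2 * g (t + 1)) (hm : m + 1 ≤ h)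
    (hup : g m ≤ g (m + 1)) {s : ℕ} (hs : c ≤ s) (hsm : s ≤ m) : g s ≤ g (m + 1) := by
  have key : ∀ k s, s + k = m → c ≤ s → g s ≤ g (s + 1) ∧ g s ≤ g (m + 1) := by
    intro k
    induction k with
    | zero =>
      rintro s rfl _
      exact ⟨hup, hup⟩
    | succ k ih =>
      intro s hs hc
      have h1 := ih (s + 1) (by omega) (by omega)
      have h2 := hg s hc (by omega)
      rw [show s + 1 + 1 = s + 2 from rfl] at h1
      omega
  exact (key (m - s) s (by omega) hs).2

theorem le_of_concave_of_ge {g : ℕ → ℕ} {c h m : ℕ}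
    (hg : ∀ t, c ≤ t → t + 2 ≤ h → g t + g (t + 2) ≤ 2 * g (t + 1)) (hm : c ≤ m)
    (hdown : g (m + 1) ≤ g m) {s : ℕ} (hs : s ≤ h) (hsm : m ≤ s) : g s ≤ g m := by
  have key : ∀ k, m + k + 1 ≤ h → g (m + k + 1) ≤ g (m + k) ∧ g (m + k + 1) ≤ g m := by
    intro k
    induction k with
    | zero => exact fun _ => ⟨hdown, hdown⟩
    | succ k ih =>
      intro hk
      have h1 := ih (by omega)
      have h2 := hg (m + k) (by omega) (by omega)
      rw [show m + (k + 1) + 1 = m + k + 2 by omega, show m + (k + 1) = m + k + 1 by omega]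
      omega
  rcases hsm.eq_or_lt with rfl | hlt
  · exact le_rfl
  · have := (key (s - m - 1) (by omega)).2
    rwa [show m + (s - m - 1) + 1 = s by omega] at this

variable {N : ℕ} {agents : List (List Job)} {l : ℕ}

/-- Binary search finds a maximum of a concave function. -/
theorem search_spec {c h : ℕ} (hch : c ≤ h)
    (hg : ∀ t, c ≤ t → t + 2 ≤ h → score N agents l t + score N agents l (t + 2) ≤
      2 * score N agents l (t + 1)) :
    (c ≤ search N agents l c h ∧ search N agents l c h ≤ h) ∧
      ∀ t, c ≤ t → t ≤ h → score N agents l t ≤ score N agents l (search N agents l c h) := by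
  have key : ∀ i, ∃ a b, (searchStep N agents l)^[i] (c, h) = (a, b) ∧ c ≤ a ∧ a ≤ b ∧ b ≤ h ∧
      b - a ≤ (h - c) / 2 ^ i ∧
      ∀ t, c ≤ t → t ≤ h → ∃ u, a ≤ u ∧ u ≤ b ∧ score N agents l t ≤ score N agents l u := by
    intro i
    induction i with
    | zero => exact ⟨c, h, rfl, le_rfl, hch, le_rfl, by simp, fun t h1 h2 => ⟨t, h1, h2, le_rfl⟩⟩
    | succ i ih =>
      obtain ⟨a, b, hab, h1, h2, h3, h4, h5⟩ := ih
      rw [Function.iterate_succ_apply', hab, pow_succ, ← Nat.div_div_eq_div_mul]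
      unfold searchStep
      dsimp only
      split_ifs with h6 h7
      · refine ⟨_, _, rfl, by omega, by omega, h3, by omega, fun t ht1 ht2 => ?_⟩
        obtain ⟨u, hu1, hu2, hu⟩ := h5 t ht1 ht2
        by_cases hu3 : u ≤ (a + b) / 2
        · exact ⟨_, le_rfl, by omega, hu.trans
            (le_of_concave_of_le hg (by omega) (by omega) (by omega) hu3)⟩
        · exact ⟨u, by omega, hu2, hu⟩
      · refine ⟨_, _, rfl, by omega, by omega, by omega, by omega, fun t ht1 ht2 => ?_⟩
        obtain ⟨u, hu1, hu2, hu⟩ := h5 t ht1 ht2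
        by_cases hu3 : u ≤ (a + b) / 2
        · exact ⟨u, by omega, hu3, hu⟩
        · exact ⟨_, by omega, le_rfl, hu.trans
            (le_of_concave_of_ge hg (by omega) (by omega) (hu2.trans h3) (by omega))⟩
      · exact ⟨a, b, rfl, h1, h2, h3, by omega, h5⟩
  obtain ⟨a, b, hab, h1, h2, h3, h4, h5⟩ := key (Nat.size (h - c))
  rw [Nat.div_eq_of_lt (Nat.lt_size_self _)] at h4
  have e : search N agents l c h = a := by rw [search, hab]
  rw [e]
  refine ⟨⟨h1, by omega⟩, fun t ht1 ht2 => ?_⟩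
  obtain ⟨u, hu1, hu2, hu⟩ := h5 t ht1 ht2
  rwa [show u = a by omega] at hu

theorem foldl_argmax (g : ℕ → ℕ) (L : List ℕ) (m : ℕ) :
    L.foldl (fun t u => if g t + 1 ≤ g u then u else t) m ∈ m :: L ∧
      ∀ x ∈ m :: L, g x ≤ g (L.foldl (fun t u => if g t + 1 ≤ g u then u else t) m) := by
  induction L generalizing m with
  | nil => simp
  | cons a L ih =>
    rw [List.foldl_cons]
    obtain ⟨h1, h2⟩ := ih (if g m + 1 ≤ g a then a else m)
    refine ⟨?_, ?_⟩
    · rcases List.mem_cons.1 h1 with h | h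
      · rw [h]
        split_ifs <;> simp
      · exact List.mem_cons_of_mem _ (List.mem_cons_of_mem _ h)
    · have h3 := h2 _ List.mem_cons_self
      intro x hx
      rcases List.mem_cons.1 hx with rfl | hx
      · refine le_trans ?_ h3
        split_ifs <;> omega
      · rcases List.mem_cons.1 hx with rfl | hx
        · refine le_trans ?_ h3
          split_ifs <;> omega
        · exact h2 x (List.mem_cons_of_mem _ hx)

theorem pieceEnd_lt {M : ℕ} {cs : List ℕ} {c b : ℕ} (hb : b ∈ cs) (hcb : c < b) :
    pieceEnd M cs c < b := by
  have h : (cs.map fun b => if b ≤ c then M + 1 else b).foldl min (M + 1) ≤ b :=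
    foldl_min_le (List.mem_map.2 ⟨b, hb, if_neg (by omega)⟩)
  unfold pieceEnd
  omega

theorem pieceEnd_le (M : ℕ) (cs : List ℕ) (c : ℕ) : pieceEnd M cs c ≤ M := by
  have h := foldl_min_le_init (cs.map fun b => if b ≤ c then M + 1 else b) (M + 1)
  unfold pieceEnd
  omega

theorem le_pieceEnd {M : ℕ} {cs : List ℕ} {c t : ℕ} (ht : t ≤ M)
    (h : ∀ b ∈ cs, c < b → t < b) : t ≤ pieceEnd M cs c := by
  unfold pieceEnd
  rcases foldl_min_mem (cs.map fun b => if b ≤ c then M + 1 else b) (M + 1) with h1 | h1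
  · omega
  · obtain ⟨b, hb, h2⟩ := List.mem_map.1 h1
    rw [← h2]
    split_ifs with h3
    · omega
    · have := h b hb (by omega)
      omega

theorem mem_candidates {c : ℕ} (hl : l ≤ N) (hc : c ∈ candidates N agents l) :
    1 ≤ c ∧ c ≤ N + 1 - l := by
  obtain ⟨b, -, rfl⟩ := List.mem_map.1 hc
  omega

theorem mem_candidates_of_breaks {b : ℕ} (hb : b ∈ breaks agents) {c : ℕ}
    (hc : c = b ∨ c = b - l) (h1 : 1 ≤ c) (h2 : c ≤ N + 1 - l) : c ∈ candidates N agents l := by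
  refine List.mem_map.2 ⟨c, List.mem_cons_of_mem _ (List.mem_flatMap.2 ⟨b, hb, ?_⟩), by omega⟩
  simpa using hc

end Search

section Score

variable {N : ℕ} {agents : List (List Job)} {l : ℕ}

theorem separated_singleton (t : ℕ) (hl : 1 ≤ l) : Separated [(t, t + l)] := by
  refine ⟨fun I hI => ?_, List.pairwise_singleton _ _⟩
  rw [List.mem_singleton.1 hI]
  dsimp only
  omega

/-- The score is the total agreement up to a constant. -/
theorem sum_agr_add (h : ∀ jobs ∈ agents, ValidJobs N jobs) (hl : 1 ≤ l) (t : ℕ) :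
    (agents.map fun jobs => agr N jobs (Finset.Ico t (t + l))).sum + (agents.map total).sum =
      agents.length * l + score N agents l t := by
  induction agents with
  | nil => simp [score]
  | cons jobs agents ih =>
    have h1 := ih fun k hk => h k (List.mem_cons_of_mem _ hk)
    have h2 := (h jobs List.mem_cons_self).agr_add_total (separated_singleton t hl)
    rw [slots_cons, slots_nil, Finset.union_empty, Nat.card_Ico] at h2
    simp only [score, List.map_cons, List.sum_cons, List.length_cons, add_mul, one_mul] at h1 ⊢
    dsimp only at h2
    change _ = _ + (total _ + _)
    omega

theorem sum_concave {α : Type} {L : List α} {f g k : α → ℕ} (h : ∀ a ∈ L, f a + g a ≤ 2 * k a) :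
    (L.map f).sum + (L.map g).sum ≤ 2 * (L.map k).sum := by
  induction L with
  | nil => simp
  | cons a L ih =>
    have h1 := ih fun b hb => h b (List.mem_cons_of_mem _ hb)
    have h2 := h a List.mem_cons_self
    simp only [List.map_cons, List.sum_cons]
    omega

theorem score_concave (h : ∀ jobs ∈ agents, ValidJobs N jobs) (hl : 1 ≤ l) {t : ℕ}
    (h1 : 1 ≤ t) (h2 : t + l + 1 ≤ N) (hb : t + 1 ∉ breaks agents)
    (hb' : t + l + 1 ∉ breaks agents) :
    score N agents l t + score N agents l (t + 2) ≤ 2 * score N agents l (t + 1) := by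
  have e0 := sum_agr_add h hl t
  have e1 := sum_agr_add h hl (t + 1)
  have e2 := sum_agr_add h hl (t + 2)
  have hequiv : ∀ s, 1 ≤ s → s + 1 ≤ N → s + 1 ∉ breaks agents → ∀ jobs ∈ agents, ∀ j ∈ jobs,
      (s ∈ window N j ↔ s + 1 ∈ window N j) := by
    intro s hs hsN hsb jobs hjobs j hj
    have h3 : s + 1 ≠ j.release ∧ s + 1 ≠ j.deadline + 1 := by
      constructor <;> intro e <;> refine hsb (List.mem_flatMap.2 ⟨jobs, hjobs,
        List.mem_flatMap.2 ⟨j, hj, ?_⟩⟩) <;> simp [e]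
    simp only [window, Finset.mem_inter, Finset.mem_Icc]
    omega
  have := sum_concave (L := agents) (f := fun jobs => agr N jobs (Finset.Ico t (t + l)))
    (g := fun jobs => agr N jobs (Finset.Ico (t + 2) (t + 2 + l)))
    (k := fun jobs => agr N jobs (Finset.Ico (t + 1) (t + 1 + l)))
    fun jobs hjobs => (h jobs hjobs).2.agr_concave hl (hequiv t h1 (by omega) hb jobs hjobs)
      (hequiv (t + l) (by omega) h2 hb' jobs hjobs)
  omega

theorem bestStart_spec (h : ∀ jobs ∈ agents, ValidJobs N jobs) (hl : 1 ≤ l) (hlN : l ≤ N) :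
    (1 ≤ bestStart N agents l ∧ bestStart N agents l ≤ N + 1 - l) ∧
      ∀ t, 1 ≤ t → t ≤ N + 1 - l → score N agents l t ≤ score N agents l (bestStart N agents l) := by
  set cs := candidates N agents l with hcs
  set e := pieceEnd (N + 1 - l) cs with he
  have hce : ∀ c ∈ cs, c ≤ e c := fun c hc =>
    le_pieceEnd (mem_candidates hlN hc).2 fun b _ hb => hb
  have hsearch : ∀ c ∈ cs, (c ≤ search N agents l c (e c) ∧ search N agents l c (e c) ≤ e c) ∧
      ∀ t, c ≤ t → t ≤ e c → score N agents l t ≤ score N agents l (search N agents l c (e c)) := by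
    intro c hc
    refine search_spec (hce c hc) fun t h1 h2 => ?_
    have h3 : e c ≤ N + 1 - l := pieceEnd_le (N + 1 - l) cs c
    have h4 := mem_candidates hlN hc
    have hno : ∀ b, t + 1 = b ∨ t + 1 = b - l → b ∉ breaks agents := by
      intro b hb hbreak
      have h5 : t + 1 ∈ cs := mem_candidates_of_breaks hbreak hb (by omega) (by omega)
      have h6 : e c < t + 1 := pieceEnd_lt h5 (by omega)
      omega
    exact score_concave h hl (by omega) (by omega) (hno _ (.inl rfl))
      (hno _ (.inr (by omega)))
  obtain ⟨h1, h2⟩ := foldl_argmax (score N agents l) (cs.map fun c => search N agents l c (e c)) 1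
  change bestStart N agents l ∈ _ at h1
  change ∀ x ∈ _, _ ≤ score N agents l (bestStart N agents l) at h2
  constructor
  · rcases List.mem_cons.1 h1 with h1 | h1
    · omega
    · obtain ⟨c, hc, h3⟩ := List.mem_map.1 h1
      have h4 := (hsearch c hc).1
      have h5 := mem_candidates hlN hc
      have h6 : e c ≤ N + 1 - l := pieceEnd_le (N + 1 - l) cs c
      omega
  · intro t ht1 ht2
    -- the last candidate up to `t`
    have hfin : {c | c ∈ cs ∧ c ≤ t}.Finite := (List.finite_toSet cs).subset fun c hc => hc.1
    obtain ⟨c, ⟨hc, hct⟩, hmax⟩ := Set.exists_max_image _ id hfin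
      ⟨1, List.mem_map.2 ⟨1, List.mem_cons_self, by omega⟩, ht1⟩
    have hte : t ≤ e c := le_pieceEnd ht2 fun b hb hcb => by
      by_contra hbt
      have := hmax b ⟨hb, by omega⟩
      simp only [id] at this
      omega
    exact ((hsearch c hc).2 t hct hte).trans
      (h2 _ (List.mem_cons_of_mem _ (List.mem_map.2 ⟨c, hc, rfl⟩)))

end Score

/-! ### Approximation algorithms with one event -/

/-- `s` is a function on valid inputs with one event that yields complete event schedules within
the factor `α` of the optimum. -/
def IsApprox (α : ℝ) (s : Instance → List ℕ) : Prop :=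
  ∀ I ∈ oneEvent, I.Valid → I.IsEventSchedule (s I) ∧
    ∀ starts, I.IsEventSchedule starts → 1 / α * (I.totalAgr starts : ℝ) ≤ I.totalAgr (s I)

theorem IsPolyTimeApprox.exists_function {C : Set Instance} {ρ : ℝ} {P : Prog}
    (h : IsPolyTimeApprox C ρ P) : ∃ s : Instance → List ℕ,
      PolyTimeOn s {I | I ∈ C ∧ I.Valid} ∧ ∀ I ∈ C, I.Valid → I.IsEventSchedule (s I) ∧
        ∀ starts, I.IsEventSchedule starts → ρ * (I.totalAgr starts : ℝ) ≤ I.totalAgr (s I) := by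
  obtain ⟨q, hq⟩ := h
  choose! s k hrun hk hs happrox using hq
  exact ⟨s, ⟨P, k, ⟨q, fun I hI => hk I hI.1 hI.2⟩, fun I hI => hrun I hI.1 hI.2⟩,
    fun I hI hv => ⟨hs I hI hv, happrox I hI hv⟩⟩

theorem PolyTimeOn.isPolyTimeApprox {C : Set Instance} {ρ : ℝ} {s : Instance → List ℕ}
    (h : PolyTimeOn s {I | I ∈ C ∧ I.Valid})
    (hs : ∀ I ∈ C, I.Valid → I.IsEventSchedule (s I) ∧
      ∀ starts, I.IsEventSchedule starts → ρ * (I.totalAgr starts : ℝ) ≤ I.totalAgr (s I)) :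
    ∃ P, IsPolyTimeApprox C ρ P := by
  obtain ⟨P, k, ⟨q, hq⟩, hrun⟩ := h
  exact ⟨P, q, fun I hI hv => ⟨s I, k I, hrun I ⟨hI, hv⟩, hq I ⟨hI, hv⟩, (hs I hI hv).1,
    (hs I hI hv).2⟩⟩

/-- The slots occupied by events of the given lengths and start slots. -/
def occ (lengths starts : List ℕ) : Finset ℕ :=
  (lengths.zip starts).toFinset.biUnion fun e => Finset.Ico e.2 (e.2 + e.1)

theorem occ_cons (l t : ℕ) (ls ts : List ℕ) :
    occ (l :: ls) (t :: ts) = Finset.Ico t (t + l) ∪ occ ls ts := by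
  simp [occ, Finset.biUnion_insert]

/-- The total agreement with a set of slots. -/
noncomputable def agreement (I : Instance) (X : Finset ℕ) : ℕ :=
  (I.agents.map fun jobs => agr I.horizon jobs X).sum

theorem totalAgr_eq (I : Instance) (starts : List ℕ) :
    I.totalAgr starts = agreement I (occ I.events starts) := rfl

/-- The start slots `ts` place events with the lengths `ls` inside the timeline. -/
def Fits (N : ℕ) (ls ts : List ℕ) : Prop :=
  List.Forall₂ (fun l t => 1 ≤ t ∧ t + l ≤ N + 1) ls ts

theorem Fits.eq_singleton {N l : ℕ} {ts : List ℕ} (h : Fits N [l] ts) :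
    ∃ t, ts = [t] ∧ 1 ≤ t ∧ t + l ≤ N + 1 := by
  obtain ⟨t, us, h1, h2, rfl⟩ := List.forall₂_cons_left_iff.1 h
  rw [List.forall₂_nil_left_iff.1 h2]
  exact ⟨t, rfl, h1⟩

theorem Instance.Valid.validJobs {I : Instance} (h : I.Valid) :
    ∀ jobs ∈ I.agents, ValidJobs I.horizon jobs := h.2

theorem isApprox_solveOne : IsApprox 1 solveOne := by
  intro I hI hv
  obtain ⟨N, events, agents⟩ := I
  obtain ⟨l, rfl⟩ : ∃ l, events = [l] := List.length_eq_one_iff.1 hI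
  have hl := hv.1 l (by simp)
  have hA := hv.validJobs
  dsimp only at hl hA
  obtain ⟨h1, h2⟩ := bestStart_spec hA hl.1 hl.2
  refine ⟨.cons (by dsimp only [List.headI_cons]; omega) .nil, fun starts hs => ?_⟩
  obtain ⟨t, rfl, ht⟩ := Fits.eq_singleton hs
  dsimp only at ht
  have h3 := h2 t ht.1 (by omega)
  have e1 := sum_agr_add hA hl.1 t
  have e2 := sum_agr_add hA hl.1 (bestStart N agents l)
  have e : ∀ u, (⟨N, [l], agents⟩ : Instance).totalAgr [u] =
      (agents.map fun jobs => agr N jobs (Finset.Ico u (u + l))).sum := fun u => by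
    rw [totalAgr_eq, occ_cons]
    simp [agreement, occ]
  rw [solveOne, e, div_one, one_mul, List.headI_cons, e]
  dsimp only
  exact_mod_cast (by omega)

/-! ### The greedy algorithm -/

/-- The input with a single event of length `l` in which the agents gain agreement relative to the
slots in `L`. -/
def stageInput (I : Instance) (L : List (ℕ × ℕ)) (l : ℕ) : Instance :=
  ⟨I.horizon, [l], I.agents.map (residual I.horizon L)⟩

/-- Places one more event by means of an algorithm `s` for one event. The first component lists the
occupied slots as disjoint intervals, and the second one the start slots. -/
def greedyStep (s : Instance → List ℕ) (I : Instance) (x : List (ℕ × ℕ) × List ℕ) (l : ℕ) :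
    List (ℕ × ℕ) × List ℕ :=
  (insertInterval (s (stageInput I x.1 l)).headI ((s (stageInput I x.1 l)).headI + l) x.1,
    (s (stageInput I x.1 l)).headI :: x.2)

/-- Places the events one after the other, the last one first, so that the start slots are
collected in the order of the events. -/
def greedy (s : Instance → List ℕ) (I : Instance) : List ℕ :=
  (I.events.reverse.foldl (greedyStep s I) ([], [])).2

section Greedy

variable {I : Instance} {s : Instance → List ℕ} {α : ℝ}

theorem agreement_mono (h : I.Valid) {X Y : Finset ℕ} (hXY : X ⊆ Y) :
    agreement I X ≤ agreement I Y :=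
  List.sum_le_sum fun jobs hj => (h.validJobs jobs hj).2.agr_mono hXY

theorem agreement_empty (h : I.Valid) : agreement I ∅ = 0 :=
  List.sum_eq_zero fun x hx => by
    obtain ⟨jobs, hj, rfl⟩ := List.mem_map.1 hx
    exact (h.validJobs jobs hj).2.agr_empty

/-- Diminishing returns: adding `Z` to a larger set gains less. -/
theorem agreement_union_add_le (h : I.Valid) {X Y : Finset ℕ} (hXY : X ⊆ Y) (Z : Finset ℕ) :
    agreement I (Y ∪ Z) + agreement I X ≤ agreement I Y + agreement I (X ∪ Z) := by
  unfold agreement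
  rw [← List.sum_map_add, ← List.sum_map_add]
  refine List.sum_le_sum fun jobs hj => ?_
  have hF := (h.validJobs jobs hj).2
  have h1 := hF.agr_submodular Y (X ∪ Z)
  have h2 : Y ∪ (X ∪ Z) = Y ∪ Z := by
    rw [← Finset.union_assoc, Finset.union_eq_left.2 hXY]
  have h3 : agr I.horizon jobs X ≤ agr I.horizon jobs (Y ∩ (X ∪ Z)) :=
    hF.agr_mono (Finset.subset_inter hXY Finset.subset_union_left)
  rw [h2] at h1
  omega

theorem agreement_stageInput (h : I.Valid) {L : List (ℕ × ℕ)} (hL : BusyList I.horizon L) (l : ℕ)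
    (Y : Finset ℕ) :
    agreement (stageInput I L l) Y + agreement I (slots L) = agreement I (slots L ∪ Y) := by
  unfold agreement stageInput
  rw [List.map_map, ← List.sum_map_add]
  congr 1
  exact List.map_congr_left fun jobs hj => (h.validJobs jobs hj).agr_residual hL Y

theorem stageInput_valid (h : I.Valid) {L : List (ℕ × ℕ)} (hL : BusyList I.horizon L) {l : ℕ}
    (hl : 1 ≤ l ∧ l ≤ I.horizon) : (stageInput I L l).Valid := by
  refine ⟨fun k hk => ?_, fun jobs hj => ?_⟩
  · rw [List.mem_singleton.1 hk]
    exact hl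
  · obtain ⟨k, hk, rfl⟩ := List.mem_map.1 hj
    exact (h.validJobs k hk).residual hL

/-- What the algorithm for one event returns in a stage of the greedy algorithm. -/
theorem IsApprox.stage (hs : IsApprox α s) (hα : 1 ≤ α) (h : I.Valid) {L : List (ℕ × ℕ)}
    (hL : BusyList I.horizon L) {l : ℕ} (hl : 1 ≤ l ∧ l ≤ I.horizon) :
    (1 ≤ (s (stageInput I L l)).headI ∧ (s (stageInput I L l)).headI + l ≤ I.horizon + 1) ∧
    ∀ u, 1 ≤ u → u + l ≤ I.horizon + 1 →
      (agreement I (slots L ∪ Finset.Ico u (u + l)) : ℝ) - agreement I (slots L) ≤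
        α * (agreement I (slots L ∪ Finset.Ico (s (stageInput I L l)).headI
          ((s (stageInput I L l)).headI + l)) - agreement I (slots L)) := by
  obtain ⟨h1, h2⟩ := hs (stageInput I L l) rfl (stageInput_valid h hL hl)
  obtain ⟨t, ht, ht1⟩ := Fits.eq_singleton h1
  rw [ht, List.headI_cons]
  refine ⟨ht1, fun u hu1 hu2 => ?_⟩
  have h3 := h2 [u] (.cons ⟨hu1, hu2⟩ .nil)
  have e : ∀ v, ((stageInput I L l).totalAgr [v] : ℝ) =
      agreement I (slots L ∪ Finset.Ico v (v + l)) - agreement I (slots L) := fun v => by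
    rw [← agreement_stageInput h hL l, totalAgr_eq]
    change (agreement _ (occ [l] [v]) : ℝ) = _
    rw [occ_cons]
    simp [occ]
  rw [ht, e, e, one_div_mul_eq_div, div_le_iff₀ (by linarith)] at h3
  linarith

/-- The state of the greedy algorithm after the events with lengths `ls` have been placed. Any
placement of these events adds to any superset of the occupied slots at most `α` times the
agreement reached. -/
structure GreedyState (α : ℝ) (I : Instance) (ls : List ℕ) (x : List (ℕ × ℕ) × List ℕ) :
    Prop where
  busy : BusyList I.horizon x.1
  fits : Fits I.horizon ls x.2
  slots_eq : slots x.1 = occ ls x.2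
  gain_le : ∀ Y, slots x.1 ⊆ Y → ∀ ts, Fits I.horizon ls ts →
    (agreement I (Y ∪ occ ls ts) : ℝ) ≤ agreement I Y + α * agreement I (slots x.1)

theorem GreedyState.step (hs : IsApprox α s) (hα : 1 ≤ α) (h : I.Valid) {ls : List ℕ}
    {x : List (ℕ × ℕ) × List ℕ} (hx : GreedyState α I ls x) {l : ℕ}
    (hl : 1 ≤ l ∧ l ≤ I.horizon) : GreedyState α I (l :: ls) (greedyStep s I x l) := by
  obtain ⟨ht, hgain⟩ := hs.stage hα h hx.busy hl
  unfold greedyStep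
  set t := (s (stageInput I x.1 l)).headI
  have hslots := hx.busy.slots_insertInterval ht.1 (show t < t + l by omega) ht.2
  refine ⟨hx.busy.insertInterval ht.1 (by omega) ht.2, .cons ht hx.fits, ?_, ?_⟩
  · rw [occ_cons, ← hx.slots_eq]
    exact hslots
  · intro Y hY ts hts
    dsimp only at hY ⊢
    rw [hslots] at hY ⊢
    obtain ⟨u, us, hu, hus, rfl⟩ := List.forall₂_cons_left_iff.1 hts
    have hXY : slots x.1 ⊆ Y := Finset.subset_union_right.trans hY
    have h1 := hx.gain_le Y hXY us hus
    have h2 := agreement_union_add_le h (hXY.trans (Finset.subset_union_left (s₂ := occ ls us)))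
      (Finset.Ico u (u + l))
    have h3 := hgain u hu.1 hu.2
    rw [occ_cons, Finset.union_comm (Finset.Ico u _), ← Finset.union_assoc,
      Finset.union_comm (Finset.Ico t _)]
    have h4 : (agreement I (Y ∪ occ ls us ∪ Finset.Ico u (u + l)) : ℝ) +
        agreement I (slots x.1) ≤ agreement I (Y ∪ occ ls us) +
          agreement I (slots x.1 ∪ Finset.Ico u (u + l)) := by exact_mod_cast h2
    linarith

theorem greedyState_foldl (hs : IsApprox α s) (hα : 1 ≤ α) (h : I.Valid) (l : List ℕ)
    (hl : ∀ a ∈ l, a ∈ I.events) :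
    GreedyState α I l.reverse (l.foldl (greedyStep s I) ([], [])) := by
  induction l using List.reverseRecOn with
  | nil =>
    refine ⟨⟨⟨by simp, .nil⟩, by simp⟩, .nil, rfl, fun Y _ ts _ => ?_⟩
    simp [occ, slots_nil, agreement_empty h]
  | append_singleton l a ih =>
    rw [List.foldl_append, List.reverse_append]
    exact (ih fun b hb => hl b (by simp [hb])).step hs hα h (h.1 a (hl a (by simp)))

theorem greedy_spec (hs : IsApprox α s) (hα : 1 ≤ α) (h : I.Valid) :
    I.IsEventSchedule (greedy s I) ∧ ∀ starts, I.IsEventSchedule starts →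
      1 / (α + 1) * (I.totalAgr starts : ℝ) ≤ I.totalAgr (greedy s I) := by
  have hg := greedyState_foldl hs hα h I.events.reverse (by simp)
  rw [List.reverse_reverse] at hg
  refine ⟨hg.fits, fun starts hst => ?_⟩
  have h1 := hg.gain_le _ (Finset.Subset.refl _) starts hst
  have h2 : (agreement I (occ I.events starts) : ℝ) ≤ _ :=
    Nat.cast_le.2 (agreement_mono h (Finset.subset_union_right
      (s₁ := slots (I.events.reverse.foldl (greedyStep s I) ([], [])).1)))
  have h3 : I.totalAgr (greedy s I) =
      agreement I (slots (I.events.reverse.foldl (greedyStep s I) ([], [])).1) := by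
    rw [hg.slots_eq]
    rfl
  rw [h3, totalAgr_eq, one_div_mul_eq_div, div_le_iff₀ (by linarith)]
  linarith

theorem polyTimeOn_greedy (hs : IsApprox α s) (hα : 1 ≤ α)
    (hp : PolyTimeOn s {I | I ∈ oneEvent ∧ I.Valid}) : PolyTimeOn (greedy s) {I | I.Valid} := by
  let E : Set (Instance × (List (ℕ × ℕ) × List ℕ) × ℕ) :=
    {x | x.1.Valid ∧ BusyList x.1.horizon x.2.1.1 ∧ 1 ≤ x.2.2 ∧ x.2.2 ≤ x.1.horizon}
  have hstage : PolyTimeOn (fun x : Instance × (List (ℕ × ℕ) × List ℕ) × ℕ =>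
      stageInput x.1 x.2.1.1 x.2.2) E :=
    PolyTime.instance_mk (PolyTime.on (by fun_prop) E) (PolyTime.on (by fun_prop) E)
      (PolyTime.on (by fun_prop) E)
  have hstart : PolyTimeOn (fun x : Instance × (List (ℕ × ℕ) × List ℕ) × ℕ =>
      (s (stageInput x.1 x.2.1.1 x.2.2)).headI) E :=
    (PolyTime.list_nat_headI.on Set.univ).comp
      (hp.comp hstage fun x hx => ⟨rfl, stageInput_valid hx.1 hx.2.1 hx.2.2⟩) fun _ _ => trivial
  have hstep : PolyTimeOn (fun x : Instance × (List (ℕ × ℕ) × List ℕ) × ℕ =>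
      greedyStep s x.1 x.2.1 x.2.2) E := by
    have h : PolyTime (fun y : (Instance × (List (ℕ × ℕ) × List ℕ) × ℕ) × ℕ =>
        (insertInterval y.2 (y.2 + y.1.2.2) y.1.2.1.1, y.2 :: y.1.2.1.2)) := by fun_prop
    exact (h.on Set.univ).comp ((PolyTime.id.on E).pair hstart) fun _ _ => trivial
  have hN : PolyTime (fun I : Instance => I.horizon + 1) := by fun_prop
  have hfold := PolyTimeOn.foldl_of_add (D := {I | I.Valid}) (E := E)
    (L := fun I : Instance => I.events.reverse) (init := fun _ => ([], []))
    (step := greedyStep s) (B := fun I => 3 * bits (I.horizon + 1) + 4)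
    (PolyTime.on (by fun_prop) _) (PolyTime.on (by fun_prop) _) hstep
    (((PolyBdd.const 3).mul (hN.bdd _)).add (.const 4))
    (fun I x l _ hE _ => by
      obtain ⟨h1, h2⟩ := (hs.stage hα hE.1 hE.2.1 hE.2.2).1
      dsimp only at h1 h2
      unfold greedyStep
      set t := (s (stageInput I x.1 l)).headI
      have h3 := PolyTime.bits_insertInterval_le t (t + l) x.1
      have h4 := bits_nat_mono h2
      have h5 : bits t ≤ bits (I.horizon + 1) := bits_nat_mono (by omega)
      rw [bits_pair, bits_cons, show bits x = bits x.1 + bits x.2 + 1 from rfl]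
      omega)
    (fun I hI l a hla => by
      have hsub : ∀ b ∈ l ++ [a], b ∈ I.events := fun b hb => by simpa using hla.subset hb
      exact ⟨hI, (greedyState_foldl hs hα hI l fun b hb => hsub b (by simp [hb])).busy,
        hI.1 a (hsub a (by simp))⟩)
  exact (PolyTime.prodSnd.on Set.univ).comp hfold fun _ _ => trivial

/-- A polynomial-time algorithm for one event yields one for all inputs. -/
theorem exists_isPolyTimeApprox (hs : IsApprox α s) (hα : 1 ≤ α)
    (hp : PolyTimeOn s {I | I ∈ oneEvent ∧ I.Valid}) :
    ∃ Q : Prog, IsPolyTimeApprox Set.univ (1 / (α + 1)) Q :=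
  ((polyTimeOn_greedy hs hα hp).subset fun _ hI => hI.2).isPolyTimeApprox
    fun _ _ hv => greedy_spec hs hα hv

end Greedy

end PSBA

theorem mainTheorem3 :
    (∀ α : ℝ, 1 ≤ α →
      (∃ P : PSBA.Prog, PSBA.IsPolyTimeApprox PSBA.oneEvent (1 / α) P) →
      ∃ Q : PSBA.Prog, PSBA.IsPolyTimeApprox Set.univ (1 / (α + 1)) Q) ∧
    ∃ Q : PSBA.Prog, PSBA.IsPolyTimeApprox Set.univ (1 / 2) Q := by
  refine ⟨fun α hα ⟨P, hP⟩ => ?_, ?_⟩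
  · obtain ⟨s, hp, hs⟩ := hP.exists_function
    exact PSBA.exists_isPolyTimeApprox hs hα hp
  · rw [← one_add_one_eq_two]
    exact PSBA.exists_isPolyTimeApprox PSBA.isApprox_solveOne le_rfl (PSBA.PolyTime.solveOne.on _)
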